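/- **Setting.** Let $W\sim\mathcal P_W$ be a random parameter in a measurable space $\mathcal W$. Let $X^n=(X_1,\dots,X_n)$ be samples generated from $W$ through a Markov kernel $\mathcal P_{X^n|W}$. Let $Z^n$ be the privatised samples obtained from $X^n$ through the tensor power $K^{\otimes n}$ of a Markov kernel $K$ (given $X^n=x^n$, the $Z_i$ are independent with laws $K(\cdot|x_i)$). Let $\hat W\in\hat{\mathcal W}$ be any (possibly randomised) estimator computed from $Z^n$, with kernel $\mathcal P_{\hat W|Z^n}$, so that $W-X^n-Z^n-\hat W$ is a Markov chain. Let $\ell:\mathcal W\times\hat{\mathcal W}\to[0,\infty)$ be a measurable loss, and for $\rho>0$ put $$L_W(\hat W,\rho)=\mathcal P_W\mathcal P_{\hat W}\big(\ell(W,\hat W)<\rho\big),\qquad L_W(\rho)=\sup_{\hat w\in\hat{\mathcal W}}\mathcal P_W\big(\ell(W,\hat w)<\rho\big).$$ Let $\varphi:[0,\infty)\to\mathbb R$ be convex with $\varphi(1)=0$, and let $\varphi^\star(0)=\sup_{t\ge0}(-\varphi(t))$. For probability measures $\nu,\mu$ let $D_\varphi(\nu\|\mu)=\int q\,\varphi(p/q)$,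 with $p,q$ the densities of $\nu,\mu$ with respect to a common dominating measure and $q\,\varphi(p/q)=p\lim_{t\to\infty}\varphi(t)/t$ where $q=0$. Let $I_\varphi(W,X^n)=D_\varphi(\mathcal P_{WX^n}\|\mathcal P_W\mathcal P_{X^n})$, and define the contraction coefficients $$\eta_\varphi(\mu,K)=\sup_{\nu\ll\mu,\ \nu\ne\mu}\frac{D_\varphi(\nu K\|\mu K)}{D_\varphi(\nu\|\mu)},\qquad \eta_\varphi(K)=\sup_\mu\eta_\varphi(\mu,K),$$ the suprema being over probability measures (the ratios $0/0$, $a/\infty$, $\infty/\infty$ and the supremum of the empty set count as $0$). Put, with $0\cdot\infty=0$, $$J=\eta_\varphi(\mathcal P_{\hat W|Z^n})\,\eta_\varphi(\mathcal P_{X^n},K^{\otimes n})\,I_\varphi(W,X^n).$$ **(i)** Let $\varphi$ be non-decreasing, with generalised inverse $\varphi^{-1}(y)=\inf\{t\ge0:\varphi(t)>y\}\in[0,\infty]$, and assume that $G_\varphi(I,L)=L\,\varphi^{-1}(I/L)$ is non-decreasing in both $I\ge0$ and $L\in(0,1]$. Then for every $\rho>0$ $$\mathcal P_{W\hat W}(\ell(W,\hat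 W))\ \ge\ \rho\left(1-L\cdot\varphi^{-1}\!\left(\frac{J+(1-L)\varphi^\star(0)}{L}\right)\right)$$ both with $L=L_W(\hat W,\rho)$ and with $L=L_W(\rho)$, in each case provided that $L>0$. **(ii)** Let $\varphi$ be non-increasing, with generalised inverse $\varphi^{-1}(y)=\inf\{t\ge0:\varphi(t)\le y\}$. Then for every $\rho>0$ $$\mathcal P_{W\hat W}(\ell(W,\hat W))\ \ge\ \rho\,\big(1-L_W(\hat W,\rho)\big)\cdot\varphi^{-1}\!\left(\frac{J+L\,\varphi^\star(0)}{1-L}\right)$$ both with $L=L_W(\hat W,\rho)$ and with $L=L_W(\rho)$, in each case provided that $L<1$ and that $L\,\varphi^\star(0)$ is not of the form $0\cdot\infty$. Consequently $\mathcal P_{W\hat W}(\ell(W,\hat W))$ is at least the supremum of each of these right-hand sides over the admissible $\rho>0$. -/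

import Mathlib

open MeasureTheory ProbabilityTheory Set
open scoped NNReal ENNReal

noncomputable section

namespace PhiRisk

/-! ### Convex functions on `[0, ∞)`

A function `φ : [0, ∞) → ℝ` is represented by `φ : ℝ → ℝ`, of which only the values on `[0, ∞)` are
ever used. -/

/-- The recession slope `φ'(∞) = lim_{t → ∞} φ(t) / t ∈ (-∞, ∞]`. For convex `φ` the slopes
`(φ(t) - φ(0)) / t` are non-decreasing in `t`, so that their supremum is this limit. -/
def recessionSlope (φ : ℝ → ℝ) : EReal :=
  ⨆ (t : ℝ) (_ : 0 < t), (((φ t - φ 0) / t : ℝ) : EReal)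

/-- The Legendre-Fenchel dual `φ⋆(y) = sup_{t ≥ 0} (t y - φ(t))`. -/
def conjugate (φ : ℝ → ℝ) (y : ℝ) : EReal :=
  ⨆ (t : ℝ) (_ : 0 ≤ t), ((t * y - φ t : ℝ) : EReal)

/-- The generalised inverse `φ⁻¹(y) = inf {t ≥ 0 : φ(t) > y}` of a non-decreasing function
(`inf ∅ = +∞`). -/
def incInverse (φ : ℝ → ℝ) (y : EReal) : EReal :=
  ⨅ (t : ℝ) (_ : 0 ≤ t) (_ : y < (φ t : EReal)), (t : EReal)

/-- The generalised inverse `φ⁻¹(y) = inf {t ≥ 0 : φ(t) ≤ y}` of a non-increasing function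
(`inf ∅ = +∞`). -/
def decInverse (φ : ℝ → ℝ) (y : EReal) : EReal :=
  ⨅ (t : ℝ) (_ : 0 ≤ t) (_ : (φ t : EReal) ≤ y), (t : EReal)

/-- The functional `G_φ(I, L) = L φ⁻¹(I / L)`. -/
def G (φ : ℝ → ℝ) (I L : ℝ) : EReal :=
  (L : EReal) * incInverse φ ((I / L : ℝ) : EReal)

/-! ### Divergences and contraction coefficients -/

open Classical in
/-- The `φ`-divergence `D_φ(ν ‖ μ) = ∫ q φ(p / q)`, where `p, q` are the densities of `ν, μ` with
respect to any dominating measure, with the usual meaning `q φ(p / q) = p φ'(∞)` where `q = 0`: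
`D_φ(ν ‖ μ) = ∫ φ(dν/dμ) dμ + φ'(∞) ν^⊥(Ω)`, where `ν^⊥` is the part of `ν` singular to `μ`.
For `φ` convex the negative part of `φ(dν/dμ)` is always `μ`-integrable, so a
non-integrable `φ(dν/dμ)` has integral `+∞`. -/
def phiDiv {Ω : Type*} [MeasurableSpace Ω] (φ : ℝ → ℝ) (ν μ : Measure Ω) : EReal :=
  if Integrable (fun x => φ ((ν.rnDeriv μ x).toReal)) μ then
    ((∫ x, φ ((ν.rnDeriv μ x).toReal) ∂μ : ℝ) : EReal)
      + recessionSlope φ * ((ν.singularPart μ univ : ℝ≥0∞) : EReal)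
  else ⊤

/-- The `φ`-mutual information `D_φ(P_{XY} ‖ P_X P_Y)` of a joint law `P_{XY}`. -/
def phiMutualInfo {𝓧 𝓨 : Type*} [MeasurableSpace 𝓧] [MeasurableSpace 𝓨] (φ : ℝ → ℝ)
    (P : Measure (𝓧 × 𝓨)) : EReal :=
  phiDiv φ P (P.fst.prod P.snd)

/-- The contraction coefficient `η_φ(μ, K) = sup_{ν ≪ μ, ν ≠ μ} D_φ(νK ‖ μK) / D_φ(ν ‖ μ)`, the
supremum being over probability measures `ν`. Both divergences are non-negative when `φ(1) = 0`;
ratios `0 / 0`, `a / ∞` and `∞ / ∞` count as `0`, and so does the supremum of the empty set. -/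
def eta {𝓧 𝓨 : Type*} [MeasurableSpace 𝓧] [MeasurableSpace 𝓨] (φ : ℝ → ℝ)
    (μ : Measure 𝓧) (K : Kernel 𝓧 𝓨) : ℝ≥0∞ :=
  ⨆ (ν : Measure 𝓧) (_ : IsProbabilityMeasure ν) (_ : ν ≪ μ) (_ : ν ≠ μ),
    (phiDiv φ (K ∘ₘ ν) (K ∘ₘ μ)).toENNReal / (phiDiv φ ν μ).toENNReal

/-- The contraction coefficient `η_φ(K) = sup_μ η_φ(μ, K)` over probability measures `μ`. -/
def etaSup {𝓧 𝓨 : Type*} [MeasurableSpace 𝓧] [MeasurableSpace 𝓨] (φ : ℝ → ℝ)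
    (K : Kernel 𝓧 𝓨) : ℝ≥0∞ :=
  ⨆ (μ : Measure 𝓧) (_ : IsProbabilityMeasure μ), eta φ μ K

/-! ### Tensor powers of a Markov kernel -/

lemma measurable_pi_kernel {𝓧 𝓩 : Type*} [MeasurableSpace 𝓧] [MeasurableSpace 𝓩]
    (K : Kernel 𝓧 𝓩) [IsMarkovKernel K] (n : ℕ) :
    Measurable (fun x : Fin n → 𝓧 => Measure.pi (fun i => K (x i))) := by
  refine Measurable.measure_of_isPiSystem_of_isProbabilityMeasure
    generateFrom_pi.symm isPiSystem_pi ?_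
  rintro _ ⟨s, hs, rfl⟩
  simp only [Measure.pi_pi]
  refine Finset.measurable_prod _ fun i _ => ?_
  exact (K.measurable_coe (hs i (mem_univ i))).comp (measurable_pi_apply i)

/-- The tensor power `K^{⊗n}`: given `(x₁, …, xₙ)`, the outputs are independent with laws
`K(x₁), …, K(xₙ)`. -/
def tensorPower {𝓧 𝓩 : Type*} [MeasurableSpace 𝓧] [MeasurableSpace 𝓩]
    (K : Kernel 𝓧 𝓩) [IsMarkovKernel K] (n : ℕ) : Kernel (Fin n → 𝓧) (Fin n → 𝓩) where
  toFun x := Measure.pi (fun i => K (x i))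
  measurable' := measurable_pi_kernel K n

/-! ### The Bayesian framework with privatised samples -/

section Framework

variable {𝓦 𝓥 𝓧 𝓩 : Type*} [MeasurableSpace 𝓦] [MeasurableSpace 𝓥] [MeasurableSpace 𝓧]
  [MeasurableSpace 𝓩] {n : ℕ}

/-- The joint law of `(W, Xⁿ)` for the prior `π` and the observation model `P_{Xⁿ|W} = P`. -/
def jointWX (π : Measure 𝓦) (P : Kernel 𝓦 (Fin n → 𝓧)) : Measure (𝓦 × (Fin n → 𝓧)) :=
  π ⊗ₘ P

/-- The joint law of `(W, Ŵ)` in the Markov chain `W - Xⁿ - Zⁿ - Ŵ`, where `Zⁿ` is obtained from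
`Xⁿ` through `K^{⊗n}` and `Ŵ` from `Zⁿ` through the estimator `P_{Ŵ|Zⁿ} = E`. -/
def jointWEst (π : Measure 𝓦) (P : Kernel 𝓦 (Fin n → 𝓧)) (K : Kernel 𝓧 𝓩) [IsMarkovKernel K]
    (E : Kernel (Fin n → 𝓩) 𝓥) : Measure (𝓦 × 𝓥) :=
  π ⊗ₘ (E ∘ₖ (tensorPower K n ∘ₖ P))

/-- The expected loss `P_{WŴ}(ℓ(W, Ŵ))` under a joint law of `(W, Ŵ)`. -/
def risk (ℓ : 𝓦 → 𝓥 → ℝ≥0) (Q : Measure (𝓦 × 𝓥)) : ℝ≥0∞ :=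
  ∫⁻ p, (ℓ p.1 p.2 : ℝ≥0∞) ∂Q

/-- `L_W(Ŵ, ρ) = P_W P_Ŵ (ℓ(W, Ŵ) < ρ)`, for a joint law of `(W, Ŵ)`. -/
def ballProb (ℓ : 𝓦 → 𝓥 → ℝ≥0) (Q : Measure (𝓦 × 𝓥)) (ρ : ℝ) : ℝ :=
  (Q.fst.prod Q.snd).real {p | (ℓ p.1 p.2 : ℝ) < ρ}

/-- The small-ball probability `L_W(ρ) = sup_ŵ P_W (ℓ(W, ŵ) < ρ)`. -/
def smallBallProb (ℓ : 𝓦 → 𝓥 → ℝ≥0) (π : Measure 𝓦) (ρ : ℝ) : ℝ :=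
  ⨆ v : 𝓥, π.real {w | (ℓ w v : ℝ) < ρ}

/-- `η_φ(P_{Ŵ|Zⁿ}) · η_φ(P_{Xⁿ}, K^{⊗n}) · I_φ(W, Xⁿ)`. -/
def contractedInfo (φ : ℝ → ℝ) (π : Measure 𝓦) (P : Kernel 𝓦 (Fin n → 𝓧)) (K : Kernel 𝓧 𝓩)
    [IsMarkovKernel K] (E : Kernel (Fin n → 𝓩) 𝓥) : EReal :=
  (etaSup φ E : EReal) * (eta φ (P ∘ₘ π) (tensorPower K n) : EReal)
    * phiMutualInfo φ (jointWX π P)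

end Framework

/-- `φ⁻¹((I + (1 - L) φ⋆(0)) / L)`, for non-decreasing `φ`. -/
def incTerm (φ : ℝ → ℝ) (I : EReal) (L : ℝ) : EReal :=
  incInverse φ ((I + ((1 - L : ℝ) : EReal) * conjugate φ 0) / (L : EReal))

/-- `φ⁻¹((I + L φ⋆(0)) / (1 - L))`, for non-increasing `φ`. -/
def decTerm (φ : ℝ → ℝ) (I : EReal) (L : ℝ) : EReal :=
  decInverse φ ((I + (L : EReal) * conjugate φ 0) / ((1 - L : ℝ) : EReal))

end PhiRisk

end

open scoped symmDiff

namespace PhiRisk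

/-! Let `B` be the event that the loss is below ρ, with probability `q` under the joint law of (W,
Ŵ) and `r` under the product of the marginals. Markov's inequality bounds the risk below by ρ(1 -
q), so the task is to bound `q` in terms of `r`. Jensen's inequality on an event and the bound φ ≥
-φ⋆(0) off it turn a divergence bound by J into r φ(q/r) ≤ J + (1 - r) φ⋆(0). This is used for `B`
when φ is non-decreasing and for its complement when φ is non-increasing, and is then solved for the
ratio by the generalised inverse.

The divergence bound is contraction conditionally on W. On arbitrary measurable spaces the laws
given W = w need not have jointly measurable densities, so W is first quantised to finitely many
cells. The law given a cell of positive mass is dominated by a multiple of the marginal, hence has a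
bounded density and a finite divergence. Both contraction coefficients then apply cell by cell, and
the sum is compared with I_φ(W, Xⁿ) (`exists_quantised_density`). Quantisation does not increase
information, because supporting lines of φ can be integrated (`integral_comp_le_of_map_eq`).

`B` itself need not be visible after quantisation, but it is approximated under both laws at once by
sets that are (`exists_seq_finiteSectionSets`). The binary inequality therefore holds along
sequences tending to `q` and `r`. `le_of_monotone_of_tendsto` and `le_of_antitone_of_tendsto` pass
to the limit and at the same time replace `r` by any admissible L ≥ `r`, which treats both choices
of L together. -/

/-! ### Convexity on the half-line and the basic data processing inequality -/

/-- The right derivative serves as slope. Only points m > 0 are used: at 0 the slope may be -∞ and φ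
may jump. -/
lemma exists_subgradient {φ : ℝ → ℝ} (hφ : ConvexOn ℝ (Ici 0) φ) :
    ∃ s : ℝ → ℝ, MonotoneOn s (Ioi 0) ∧ ∀ m, 0 < m → ∀ t, 0 ≤ t → φ m + s m * (t - m) ≤ φ t := by
  refine ⟨fun m => derivWithin φ (Ioi m) m, ?_, fun m hm t ht => ?_⟩
  · have := hφ.monotoneOn_rightDeriv
    rwa [interior_Ici] at this
  · have hmi : m ∈ interior (Ici (0 : ℝ)) := by rw [interior_Ici]; exact hm
    rcases lt_trichotomy m t with h | h | h
    · have := hφ.rightDeriv_le_slope_of_mem_interior hmi (show t ∈ Ici (0 : ℝ) from ht) h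
      rw [slope_def_field, le_div_iff₀ (by linarith)] at this
      linarith
    · subst h; simp
    · have h1 := hφ.slope_le_leftDeriv_of_mem_interior (show t ∈ Ici (0 : ℝ) from ht) hmi h
      have h2 := hφ.leftDeriv_le_rightDeriv_of_mem_interior hmi
      have h3 := h1.trans h2
      rw [slope_def_field, div_le_iff₀ (by linarith)] at h3
      linarith

/-- Convexity gives continuity on the open half-line; the value at 0 is patched in separately. -/
lemma measurable_comp_of_convexOn {Ω : Type*} [MeasurableSpace Ω] {φ : ℝ → ℝ}
    (hφ : ConvexOn ℝ (Ici 0) φ) {f : Ω → ℝ} (hf : Measurable f) (h0 : ∀ x, 0 ≤ f x) :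
    Measurable (fun x => φ (f x)) := by
  classical
  have hc : ContinuousOn φ (Ioi 0) := by
    have := hφ.continuousOn_interior
    rwa [interior_Ici] at this
  have hm : Measurable ((Ioi (0 : ℝ)).piecewise φ (fun _ => φ 0)) :=
    hc.measurable_piecewise continuousOn_const measurableSet_Ioi
  convert hm.comp hf using 2 with x
  rcases (h0 x).eq_or_lt with h | h
  · simp [← h]
  · simp [piecewise, h]

/-- The upper bound comes from the endpoints of `[0, C]`, the lower one from the supporting line at
1. -/
lemma exists_abs_le_of_convexOn {φ : ℝ → ℝ} (hφ : ConvexOn ℝ (Ici 0) φ) (C : ℝ) :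
    ∃ B, ∀ t, 0 ≤ t → t ≤ C → |φ t| ≤ B := by
  obtain ⟨s, -, hs⟩ := exists_subgradient hφ
  refine ⟨max (max (φ 0) (φ C)) (|s 1| * (C + 1) - φ 1), fun t h0 hC => ?_⟩
  rw [abs_le]
  constructor
  · have h1 := hs 1 one_pos t h0
    have h2 : -(|s 1| * (C + 1)) ≤ s 1 * (t - 1) := by
      have : |s 1 * (t - 1)| ≤ |s 1| * (C + 1) := by
        rw [abs_mul]
        gcongr
        rw [abs_le]; constructor <;> linarith
      exact (abs_le.mp this).1
    have := le_max_right (max (φ 0) (φ C)) (|s 1| * (C + 1) - φ 1)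
    linarith
  · exact le_trans (hφ.le_max_of_mem_Icc (x := 0) (y := C) (by simp) (by simp; linarith) ⟨h0, hC⟩)
      (le_max_left _ _)

/-- Jensen's inequality for a convex function on `[0, ∞)` that may be discontinuous at `0`. -/
lemma measureReal_mul_le_integral {Ω : Type*} [MeasurableSpace Ω] {φ : ℝ → ℝ}
    (hφ : ConvexOn ℝ (Ici 0) φ) {μ : Measure Ω} [IsFiniteMeasure μ] {f : Ω → ℝ}
    (h0 : ∀ x, 0 ≤ f x) (hf : Integrable f μ) (hint : Integrable (fun x => φ (f x)) μ) :
    μ.real univ * φ ((∫ x, f x ∂μ) / μ.real univ) ≤ ∫ x, φ (f x) ∂μ := by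
  obtain ⟨s, -, hs⟩ := exists_subgradient hφ
  rcases eq_or_ne μ 0 with rfl | hR
  · simp
  have hpos : 0 < μ.real univ := by
    simpa [Measure.real, ENNReal.toReal_pos_iff, pos_iff_ne_zero] using hR
  -- Mean zero is treated apart, since there may be no supporting line at 0; then `f` vanishes
  -- almost everywhere.
  rcases (integral_nonneg (μ := μ) (f := f) fun x => h0 x).eq_or_lt with h | h
  · have hz : f =ᵐ[μ] 0 := (integral_eq_zero_iff_of_nonneg h0 hf).mp h.symm
    have : ∫ x, φ (f x) ∂μ = ∫ _, φ 0 ∂μ := by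
      refine integral_congr_ae ?_
      filter_upwards [hz] with x hx
      simp [hx]
    rw [this, ← h]
    simp
  · set m := (∫ x, f x ∂μ) / μ.real univ with hm
    have hmpos : 0 < m := div_pos h hpos
    have h1 : ∫ x, (φ m + s m * (f x - m)) ∂μ ≤ ∫ x, φ (f x) ∂μ := by
      refine integral_mono ?_ hint fun x => hs m hmpos _ (h0 x)
      exact (integrable_const _).add ((hf.sub (integrable_const _)).const_mul _)
    have hfm : Integrable (fun x => f x - m) μ := hf.sub (integrable_const _)
    rw [integral_add (integrable_const _) (hfm.const_mul _), integral_const_mul,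
      integral_sub hf (integrable_const _)] at h1
    have h2 : ∫ x, f x ∂μ = μ.real univ * m := by rw [hm]; field_simp
    simp only [integral_const, smul_eq_mul, h2, sub_self, mul_zero, add_zero] at h1
    exact h1

/-- The data processing inequality behind all others: if `u` is the density of `Q` with respect to
`μ` on the `σ`-algebra generated by `u`, then `∫ φ(u) dR` is at most the divergence of `Q` from
`μ`. -/
lemma integral_comp_le_of_map_eq {Ω : Type*} [MeasurableSpace Ω] {φ : ℝ → ℝ}
    (hφ : ConvexOn ℝ (Ici 0) φ) {Q μ σ : Measure Ω} [IsFiniteMeasure Q] [IsFiniteMeasure μ]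
    {F : Ω → ℝ≥0∞} (hF : Measurable F) (hQ : Q = μ.withDensity F + σ)
    {u : Ω → ℝ} (hu : Measurable u) {C : ℝ} (h0 : ∀ x, 0 ≤ u x) (hC : ∀ x, u x ≤ C)
    (hmap : Q.map u = (μ.withDensity fun x => ENNReal.ofReal (u x)).map u)
    (hint : Integrable (fun x => φ (F x).toReal) μ) {M : ℝ}
    (hM : σ = 0 ∨ ∀ t, 0 < t → φ t - φ 0 ≤ M * t) :
    ∫ x, φ (u x) ∂μ ≤ ∫ x, φ (F x).toReal ∂μ + M * σ.real univ := by
  obtain ⟨s, hsm, hs⟩ := exists_subgradient hφ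
  have hσQ : σ ≤ Q := by rw [hQ]; exact Measure.le_add_left le_rfl
  have hFQ : μ.withDensity F ≤ Q := by rw [hQ]; exact Measure.le_add_right le_rfl
  have : IsFiniteMeasure σ := isFiniteMeasure_of_le Q hσQ
  have : IsFiniteMeasure (μ.withDensity F) := isFiniteMeasure_of_le Q hFQ
  have hFlint : ∫⁻ x, F x ∂μ ≠ ∞ := by
    have := measure_ne_top (μ.withDensity F) univ
    rwa [withDensity_apply _ .univ, setLIntegral_univ] at this
  have hFtop : ∀ᵐ x ∂μ, F x < ∞ := ae_lt_top hF hFlint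
  have hFint : Integrable (fun x => (F x).toReal) μ :=
    integrable_toReal_of_lintegral_ne_top hF.aemeasurable hFlint
  -- The measure `u μ` does not charge `{u = 0}`, and `Q` has the same image under `u`.
  have hQ0 : Q {x | u x = 0} = 0 := by
    have : Q {x | u x = 0} = Q.map u {0} := by
      rw [Measure.map_apply hu (measurableSet_singleton 0)]; rfl
    rw [this, hmap, Measure.map_apply hu (measurableSet_singleton 0),
      withDensity_apply _ (hu (measurableSet_singleton 0))]
    rw [setLIntegral_congr_fun (g := fun _ => 0) (hu (measurableSet_singleton 0))]
    · simp
    · intro x hx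
      have : u x = 0 := hx
      simp [this]
  have hσ0 : ∀ᵐ x ∂σ, 0 < u x := by
    have : σ {x | u x = 0} = 0 := le_antisymm ((hσQ _).trans hQ0.le) zero_le
    rw [ae_iff]
    refine measure_mono_null (fun x hx => ?_) this
    exact le_antisymm (not_lt.mp hx) (h0 x)
  have hF0 : ∀ᵐ x ∂μ, u x = 0 → F x = 0 := by
    have hms : MeasurableSet {x | u x = 0} := hu (measurableSet_singleton 0)
    have : μ.withDensity F {x | u x = 0} = 0 := le_antisymm ((hFQ _).trans hQ0.le) zero_le
    rw [withDensity_apply _ hms, lintegral_eq_zero_iff hF] at this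
    exact (ae_restrict_iff' hms).mp this
  -- A supporting line of slope above `M` would overtake `φ 0 + M t` for large `t`; the `t` below
  -- lies past the crossing point.
  have hMs : σ = 0 ∨ ∀ m, 0 < m → s m ≤ M := by
    refine hM.imp id fun h m hm => ?_
    by_contra! hlt
    set t := max m ((s m * m - φ m + φ 0) / (s m - M) + 1) with ht
    have ht0 : 0 < t := lt_of_lt_of_le hm (le_max_left _ _)
    have h1 := h t ht0
    have h2 := hs m hm t ht0.le
    have h3 : (s m * m - φ m + φ 0) / (s m - M) < t :=
      lt_of_lt_of_le (lt_add_one _) (le_max_right _ _)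
    rw [div_lt_iff₀ (by linarith)] at h3
    nlinarith
  -- Supporting lines are taken at `max u ε`, which keeps the slopes bounded even if they tend to -∞
  -- at 0. Where `u = 0` none is needed, because `F = 0` there as well.
  have key : ∀ ε, 0 < ε → ε ≤ 1 →
      ∫ x, φ (if 0 < u x then max (u x) ε else 0) ∂μ
        ≤ ∫ x, φ (F x).toReal ∂μ + M * σ.real univ + ε * (max (s 1) 0 * μ.real univ) := by
    intro ε hε hε1
    set k : ℝ → ℝ := fun t => if 0 < t then s (max t ε) else 0 with hk
    have hkm : Measurable k := by
      refine Measurable.ite measurableSet_Ioi ?_ measurable_const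
      refine Monotone.measurable fun a b hab => ?_
      exact hsm (lt_of_lt_of_le hε (le_max_right _ _)) (lt_of_lt_of_le hε (le_max_right _ _))
        (max_le_max_right _ hab)
    obtain ⟨B, hB⟩ : ∃ B, ∀ x, ‖k (u x)‖ ≤ B := by
      refine ⟨max |s ε| |s (max C ε)|, fun x => ?_⟩
      simp only [hk]
      split_ifs with h
      · have hp : (0:ℝ) < max (u x) ε := lt_of_lt_of_le hε (le_max_right _ _)
        have h1 : s ε ≤ s (max (u x) ε) := hsm hε hp (le_max_right _ _)
        have h2 : s (max (u x) ε) ≤ s (max C ε) :=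
          hsm hp (lt_of_lt_of_le hε (le_max_right _ _)) (max_le_max_right _ (hC x))
        rw [Real.norm_eq_abs]
        exact abs_le_max_abs_abs h1 h2
      · simp
    have hkint : ∀ ν : Measure Ω, IsFiniteMeasure ν → Integrable (fun x => k (u x)) ν :=
      fun ν _ => Integrable.of_bound (hkm.comp hu).aestronglyMeasurable B (ae_of_all _ hB)
    have huint : Integrable (fun x => k (u x) * u x) μ := by
      refine Integrable.of_bound ((hkm.comp hu).mul hu).aestronglyMeasurable (B * C)
        (ae_of_all _ fun x => ?_)
      rw [norm_mul]
      have := hB x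
      have h2 : ‖u x‖ ≤ C := by rw [Real.norm_of_nonneg (h0 x)]; exact hC x
      have h3 : 0 ≤ B := (norm_nonneg _).trans this
      gcongr
    have hFkint : Integrable (fun x => k (u x) * (F x).toReal) μ :=
      hFint.bdd_mul (hkm.comp hu).aestronglyMeasurable (ae_of_all _ hB)
    -- The slope is a function of `u` alone, so it has the same integral under `Q` and under `u μ`.
    -- This cancels the linear terms up to the singular part.
    have hid : ∫ x, k (u x) * (F x).toReal ∂μ + ∫ x, k (u x) ∂σ = ∫ x, k (u x) * u x ∂μ := by
      have e1 : ∫ x, k (u x) ∂Q = ∫ x, k (u x) ∂(μ.withDensity fun x => ENNReal.ofReal (u x)) := by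
        rw [← integral_map hu.aemeasurable hkm.aestronglyMeasurable, hmap,
          integral_map hu.aemeasurable hkm.aestronglyMeasurable]
      rw [hQ, integral_add_measure (hkint _ inferInstance) (hkint _ inferInstance),
        integral_withDensity_eq_integral_toReal_smul hF hFtop,
        integral_withDensity_eq_integral_toReal_smul hu.ennreal_ofReal (by simp)] at e1
      simp only [smul_eq_mul, ENNReal.toReal_ofReal (h0 _)] at e1
      simpa only [mul_comm] using e1
    have hσk : ∫ x, k (u x) ∂σ ≤ M * σ.real univ := by
      rcases hMs with rfl | h
      · simp
      · calc ∫ x, k (u x) ∂σ ≤ ∫ _, M ∂σ := by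
              refine integral_mono_ae (hkint _ inferInstance) (integrable_const _) ?_
              filter_upwards [hσ0] with x hx
              simp only [hk, if_pos hx]
              exact h _ (lt_of_lt_of_le hε (le_max_right _ _))
          _ = M * σ.real univ := by simp [mul_comm]
    have hvm : Measurable fun x => (if 0 < u x then max (u x) ε else 0 : ℝ) :=
      Measurable.ite (hu measurableSet_Ioi) (hu.max measurable_const) measurable_const
    have hv0 : ∀ x, 0 ≤ (if 0 < u x then max (u x) ε else 0 : ℝ) := fun x => by
      split_ifs <;> simp [hε.le]
    have hvint : Integrable (fun x => φ (if 0 < u x then max (u x) ε else 0)) μ := by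
      obtain ⟨B', hB'⟩ := exists_abs_le_of_convexOn hφ (max C ε)
      refine Integrable.of_bound (measurable_comp_of_convexOn hφ hvm hv0).aestronglyMeasurable B'
        (ae_of_all _ fun x => hB' _ (hv0 x) ?_)
      split_ifs
      · exact max_le_max_right _ (hC x)
      · exact hε.le.trans (le_max_right _ _)
    have hpt : ∀ᵐ x ∂μ, φ (if 0 < u x then max (u x) ε else 0)
        + (k (u x) * (F x).toReal - k (u x) * u x) - ε * max (s 1) 0 ≤ φ (F x).toReal := by
      filter_upwards [hF0] with x hx
      have hc : 0 ≤ ε * max (s 1) 0 := by positivity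
      rcases (h0 x).eq_or_lt with h | h
      · simp only [hk, ← h, hx h.symm]
        simpa using hc
      · have h1 := hs (max (u x) ε) (lt_of_lt_of_le h (le_max_left _ _)) (F x).toReal
          ENNReal.toReal_nonneg
        simp only [hk, if_pos h]
        -- The price of touching φ at `ε` instead of `u` when `u < ε`.
        have h2 : s (max (u x) ε) * (max (u x) ε - u x) ≤ ε * max (s 1) 0 := by
          rcases le_total ε (u x) with h3 | h3
          · rw [max_eq_left h3]; simpa using hc
          · rw [max_eq_right h3]
            have h4 : s ε ≤ s 1 := hsm hε (mem_Ioi.2 one_pos) hε1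
            calc s ε * (ε - u x) ≤ max (s 1) 0 * (ε - u x) :=
                  mul_le_mul_of_nonneg_right (h4.trans (le_max_left _ _)) (by linarith)
              _ ≤ max (s 1) 0 * ε := by gcongr; linarith
              _ = _ := mul_comm _ _
        linarith
    have := integral_mono_ae ((hvint.add (hFkint.sub huint)).sub (integrable_const _)) hint hpt
    simp only [Pi.add_apply, Pi.sub_apply] at this
    rw [integral_sub (by exact hvint.add (hFkint.sub huint)) (integrable_const _),
      integral_add hvint (by exact hFkint.sub huint), integral_sub hFkint huint] at this
    simp only [integral_const, smul_eq_mul] at this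
    linarith
  have hlim : Filter.Tendsto
      (fun n : ℕ => ∫ x, φ (if 0 < u x then max (u x) (1 / (n + 1)) else 0) ∂μ) Filter.atTop (nhds (∫ x, φ (u x) ∂μ)) := by
    obtain ⟨B', hB'⟩ := exists_abs_le_of_convexOn hφ (max C 1)
    have hn0 : ∀ n : ℕ, (0 : ℝ) ≤ 1 / (n + 1) := fun n => by positivity
    have hv0 : ∀ (n : ℕ) x, 0 ≤ (if 0 < u x then max (u x) (1 / (n + 1)) else 0 : ℝ) := fun n x => by
      split_ifs
      · exact (hn0 n).trans (le_max_right _ _)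
      · exact le_rfl
    refine tendsto_integral_of_dominated_convergence (fun _ => B') (fun n => ?_)
      (integrable_const _) (fun n => ae_of_all _ fun x => ?_) (ae_of_all _ fun x => ?_)
    · refine (measurable_comp_of_convexOn hφ ?_ (hv0 n)).aestronglyMeasurable
      exact Measurable.ite (hu measurableSet_Ioi) (hu.max measurable_const) measurable_const
    · refine hB' _ (hv0 n x) ?_
      split_ifs
      · refine max_le_max (hC x) ?_
        rw [div_le_one (by positivity)]
        linarith [(Nat.cast_nonneg n : (0:ℝ) ≤ n)]
      · exact zero_le_one.trans (le_max_right _ _)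
    -- At each point the truncation is eventually inactive, so no continuity of φ is required, in
    -- particular not at 0.
    · refine tendsto_const_nhds.congr' ?_
      rcases (h0 x).eq_or_lt with h | h
      · simp [← h]
      · filter_upwards [(tendsto_one_div_add_atTop_nhds_zero_nat (𝕜 := ℝ)).eventually_lt_const h]
          with n hn
        rw [if_pos h, max_eq_left hn.le]
  have hlim2 : Filter.Tendsto (fun n : ℕ => ∫ x, φ (F x).toReal ∂μ + M * σ.real univ
      + 1 / ((n : ℝ) + 1) * (max (s 1) 0 * μ.real univ)) Filter.atTop
      (nhds (∫ x, φ (F x).toReal ∂μ + M * σ.real univ + 0 * (max (s 1) 0 * μ.real univ))) :=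
    ((tendsto_one_div_add_atTop_nhds_zero_nat (𝕜 := ℝ)).mul_const _).const_add _
  rw [zero_mul, add_zero] at hlim2
  refine le_of_tendsto_of_tendsto' hlim hlim2 fun n => key _ (by positivity) ?_
  rw [div_le_one (by positivity)]
  linarith [(Nat.cast_nonneg n : (0:ℝ) ≤ n)]

/-! ### Bounded densities -/

section Density

variable {Ω : Type*} [MeasurableSpace Ω]

/-- The Radon-Nikodym derivative is at most `C` only almost everywhere; truncating it gives bounds
at every point, which make all later integrals of φ finite. -/
lemma exists_bounded_density {ν μ : Measure Ω} [IsFiniteMeasure ν] [IsFiniteMeasure μ] {C : ℝ}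
    (h0 : 0 ≤ C) (h : ν ≤ ENNReal.ofReal C • μ) :
    ∃ g : Ω → ℝ, Measurable g ∧ (∀ x, 0 ≤ g x) ∧ (∀ x, g x ≤ C) ∧
      ν = μ.withDensity fun x => ENNReal.ofReal (g x) := by
  have hac : ν ≪ μ := Measure.absolutelyContinuous_of_le_smul h
  have hle : ∀ᵐ x ∂μ, ν.rnDeriv μ x ≤ ENNReal.ofReal C := by
    refine ae_le_of_forall_setLIntegral_le_of_sigmaFinite (Measure.measurable_rnDeriv ν μ)
      fun s _ _ => ?_
    calc ∫⁻ x in s, ν.rnDeriv μ x ∂μ ≤ ν s := Measure.setLIntegral_rnDeriv_le s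
      _ ≤ (ENNReal.ofReal C • μ) s := h s
      _ = ∫⁻ _ in s, ENNReal.ofReal C ∂μ := by simp
  refine ⟨fun x => min (ν.rnDeriv μ x).toReal C,
    (Measure.measurable_rnDeriv ν μ).ennreal_toReal.min measurable_const,
    fun x => le_min ENNReal.toReal_nonneg h0, fun x => min_le_right _ _, ?_⟩
  conv_lhs => rw [← Measure.withDensity_rnDeriv_eq ν μ hac]
  refine withDensity_congr_ae ?_
  filter_upwards [hle] with x hx
  have hx' : (ν.rnDeriv μ x).toReal ≤ C := by
    rw [← ENNReal.toReal_ofReal h0]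
    exact ENNReal.toReal_mono ENNReal.ofReal_ne_top hx
  rw [min_eq_left hx', ENNReal.ofReal_toReal (ne_top_of_le_ne_top ENNReal.ofReal_ne_top hx)]

lemma integrable_comp_of_bounded {φ : ℝ → ℝ} (hφ : ConvexOn ℝ (Ici 0) φ) {μ : Measure Ω}
    [IsFiniteMeasure μ] {g : Ω → ℝ} {C : ℝ} (hg : Measurable g) (h0 : ∀ x, 0 ≤ g x)
    (hC : ∀ x, g x ≤ C) : Integrable (fun x => φ (g x)) μ := by
  obtain ⟨B, hB⟩ := exists_abs_le_of_convexOn hφ C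
  exact Integrable.of_bound (measurable_comp_of_convexOn hφ hg h0).aestronglyMeasurable B
    (ae_of_all _ fun x => hB _ (h0 x) (hC x))

lemma phiDiv_withDensity {φ : ℝ → ℝ} (hφ : ConvexOn ℝ (Ici 0) φ) {μ : Measure Ω}
    [IsFiniteMeasure μ] {g : Ω → ℝ} {C : ℝ} (hg : Measurable g) (h0 : ∀ x, 0 ≤ g x)
    (hC : ∀ x, g x ≤ C) :
    phiDiv φ (μ.withDensity fun x => ENNReal.ofReal (g x)) μ = ((∫ x, φ (g x) ∂μ : ℝ) : EReal) := by
  have hae : (fun x => φ ((μ.withDensity fun x => ENNReal.ofReal (g x)).rnDeriv μ x).toReal)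
      =ᵐ[μ] fun x => φ (g x) := by
    filter_upwards [Measure.rnDeriv_withDensity μ hg.ennreal_ofReal] with x hx
    rw [hx, ENNReal.toReal_ofReal (h0 x)]
  have hi := integrable_comp_of_bounded (μ := μ) hφ hg h0 hC
  have hs : (μ.withDensity fun x => ENNReal.ofReal (g x)).singularPart μ = 0 :=
    Measure.singularPart_eq_zero_of_ac (withDensity_absolutelyContinuous _ _)
  rw [phiDiv, if_pos ((integrable_congr hae).mpr hi), integral_congr_ae hae, hs]
  simp

end Density

/-! ### Contraction of a single law by a kernel -/

section Kernel

variable {𝓧 𝓨 : Type*} [MeasurableSpace 𝓧] [MeasurableSpace 𝓨]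

lemma comp_le_smul_comp {ν μ : Measure 𝓧} {c : ℝ≥0∞} (h : ν ≤ c • μ) (κ : Kernel 𝓧 𝓨) :
    κ ∘ₘ ν ≤ c • (κ ∘ₘ μ) := by
  rw [← Measure.comp_smul]
  refine Measure.le_iff.mpr fun s hs => ?_
  rw [Measure.bind_apply hs κ.aemeasurable, Measure.bind_apply hs κ.aemeasurable]
  exact lintegral_mono' h le_rfl

lemma withDensity_compProd {μ : Measure 𝓧} [IsFiniteMeasure μ] {f : 𝓧 → ℝ≥0∞} (hf : Measurable f)
    [IsFiniteMeasure (μ.withDensity f)] (κ : Kernel 𝓧 𝓨) [IsMarkovKernel κ] :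
    (μ.withDensity f) ⊗ₘ κ = (μ ⊗ₘ κ).withDensity fun p => f p.1 := by
  ext s hs
  rw [Measure.compProd_apply hs, withDensity_apply _ hs,
    lintegral_withDensity_eq_lintegral_mul _ hf (Kernel.measurable_kernel_prodMk_left hs),
    ← lintegral_indicator hs, Measure.lintegral_compProd (f := s.indicator fun p => f p.1)
      ((hf.comp measurable_fst).indicator hs)]
  refine lintegral_congr fun x => ?_
  have : (fun y => s.indicator (fun p : 𝓧 × 𝓨 => f p.1) (x, y))
      = (Prod.mk x ⁻¹' s).indicator fun _ => f x := by
    rfl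
  rw [this, lintegral_indicator (measurable_prodMk_left hs)]
  simp

/-- On the joint space of input and output, `g` of the output is the density after forgetting
everything but its own value, so the basic inequality applies with `u = g(y)`, `F = f(x)` and no
singular part. -/
lemma integral_density_comp_le {φ : ℝ → ℝ} (hφ : ConvexOn ℝ (Ici 0) φ) {μ : Measure 𝓧}
    [IsProbabilityMeasure μ] (κ : Kernel 𝓧 𝓨) [IsMarkovKernel κ] {f : 𝓧 → ℝ} {g : 𝓨 → ℝ} {C : ℝ}
    (hf : Measurable f) (hf0 : ∀ x, 0 ≤ f x) (hfC : ∀ x, f x ≤ C)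
    (hg : Measurable g) (hg0 : ∀ y, 0 ≤ g y) (hgC : ∀ y, g y ≤ C)
    (h : κ ∘ₘ (μ.withDensity fun x => ENNReal.ofReal (f x))
      = (κ ∘ₘ μ).withDensity fun y => ENNReal.ofReal (g y)) :
    ∫ y, φ (g y) ∂(κ ∘ₘ μ) ≤ ∫ x, φ (f x) ∂μ := by
  have hfin : IsFiniteMeasure (μ.withDensity fun x => ENNReal.ofReal (f x)) := by
    refine isFiniteMeasure_withDensity_ofReal ?_
    refine (HasFiniteIntegral.of_bounded (C := C) (ae_of_all _ fun x => ?_))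
    rw [Real.norm_of_nonneg (hf0 x)]; exact hfC x
  have hcp := withDensity_compProd (μ := μ) hf.ennreal_ofReal κ
  have hsnd : ∀ ν : Measure 𝓧, [SFinite ν] → (ν ⊗ₘ κ).map Prod.snd = κ ∘ₘ ν :=
    fun ν _ => Measure.snd_compProd ν κ
  have hkey := integral_comp_le_of_map_eq (Ω := 𝓧 × 𝓨) hφ
    (Q := (μ.withDensity fun x => ENNReal.ofReal (f x)) ⊗ₘ κ) (μ := μ ⊗ₘ κ) (σ := 0)
    (F := fun p => ENNReal.ofReal (f p.1)) (u := fun p => g p.2) (C := C) (M := 0)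
    (hf.comp measurable_fst).ennreal_ofReal (by rw [hcp, add_zero]) (hg.comp measurable_snd)
    (fun _ => hg0 _) (fun _ => hgC _) ?_ ?_ (Or.inl rfl)
  · simp only [ENNReal.toReal_ofReal (hf0 _), zero_mul, add_zero] at hkey
    have h1 : ∫ p, φ (g p.2) ∂(μ ⊗ₘ κ) = ∫ y, φ (g y) ∂(κ ∘ₘ μ) := by
      rw [← hsnd μ, integral_map measurable_snd.aemeasurable
        (measurable_comp_of_convexOn hφ hg hg0).aestronglyMeasurable]
    have h2 : ∫ p, φ (f p.1) ∂(μ ⊗ₘ κ) = ∫ x, φ (f x) ∂μ := by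
      conv_rhs => rw [← Measure.fst_compProd μ κ, Measure.fst]
      rw [integral_map measurable_fst.aemeasurable
        (measurable_comp_of_convexOn hφ hf hf0).aestronglyMeasurable]
    rwa [h1, h2] at hkey
  · ext S hS
    have hS' : MeasurableSet (g ⁻¹' S) := hg hS
    have e1 : (fun p : 𝓧 × 𝓨 => g p.2) ⁻¹' S = Prod.snd ⁻¹' (g ⁻¹' S) := rfl
    have hgs : Measurable fun p : 𝓧 × 𝓨 => g p.2 := hg.comp measurable_snd
    rw [Measure.map_apply hgs hS, Measure.map_apply hgs hS,
      e1, ← Measure.map_apply measurable_snd hS', hsnd, h, withDensity_apply _ hS',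
      withDensity_apply _ (measurable_snd hS'), ← hsnd μ,
      setLIntegral_map hS' hg.ennreal_ofReal measurable_snd]
  · simp only [ENNReal.toReal_ofReal (hf0 _)]
    exact integrable_comp_of_bounded hφ (hf.comp measurable_fst) (fun _ => hf0 _) (fun _ => hfC _)

/-- The coefficient is a supremum of quotients; clearing the denominator needs it finite, which
domination ensures, and nonzero. If it is zero, ordinary data processing makes the left side zero
too. -/
lemma toENNReal_phiDiv_comp_le {φ : ℝ → ℝ} (hφ : ConvexOn ℝ (Ici 0) φ) (hφ1 : φ 1 = 0)
    {ν μ : Measure 𝓧} [IsProbabilityMeasure ν] [IsProbabilityMeasure μ] {C : ℝ} (hC : 0 ≤ C)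
    (h : ν ≤ ENNReal.ofReal C • μ) (κ : Kernel 𝓧 𝓨) [IsMarkovKernel κ] :
    (phiDiv φ (κ ∘ₘ ν) (κ ∘ₘ μ)).toENNReal ≤ eta φ μ κ * (phiDiv φ ν μ).toENNReal := by
  obtain ⟨f, hf, hf0, hfC, hν⟩ := exists_bounded_density hC h
  obtain ⟨g, hg, hg0, hgC, hκ⟩ := exists_bounded_density hC (comp_le_smul_comp h κ)
  have hac : ν ≪ μ := Measure.absolutelyContinuous_of_le_smul h
  have hle : phiDiv φ (κ ∘ₘ ν) (κ ∘ₘ μ) ≤ phiDiv φ ν μ := by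
    rw [hκ, phiDiv_withDensity hφ hg hg0 hgC]
    conv_rhs => rw [hν, phiDiv_withDensity hφ hf hf0 hfC]
    refine EReal.coe_le_coe_iff.mpr (integral_density_comp_le hφ κ hf hf0 hfC hg hg0 hgC ?_)
    rw [← hν, hκ]
  have hfin : (phiDiv φ ν μ).toENNReal ≠ ∞ := by
    rw [hν, phiDiv_withDensity hφ hf hf0 hfC]
    simp
  rcases eq_or_ne (phiDiv φ ν μ).toENNReal 0 with h0 | h0
  · exact (EReal.toENNReal_le_toENNReal hle).trans (by rw [h0]; exact zero_le)
  -- The case `ν = μ` is excluded from the supremum, but then the divergence is `φ 1 = 0`.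
  rcases eq_or_ne ν μ with rfl | hne
  · exfalso
    apply h0
    have := phiDiv_withDensity (μ := ν) hφ (g := fun _ => 1) measurable_const
      (fun _ => zero_le_one) (C := 1) (fun _ => le_rfl)
    simp only [ENNReal.ofReal_one, withDensity_const, one_smul, hφ1, integral_zero] at this
    simp [this]
  · rw [← ENNReal.div_le_iff h0 hfin]
    exact le_iSup₂_of_le ν inferInstance (le_iSup₂_of_le hac hne le_rfl)

lemma eta_le_etaSup (φ : ℝ → ℝ) (μ : Measure 𝓧) [IsProbabilityMeasure μ] (κ : Kernel 𝓧 𝓨) :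
    eta φ μ κ ≤ etaSup φ κ :=
  le_iSup₂_of_le μ inferInstance le_rfl

end Kernel

/-! ### Quantising the parameter -/

section Cells

variable {𝓦 𝓨 ι : Type*} [MeasurableSpace 𝓦] [MeasurableSpace 𝓨]

/-- The conditional law of the output of the kernel `κ` given `idx = i`. -/
noncomputable def cellLaw (π : Measure 𝓦) (idx : 𝓦 → ι) (κ : Kernel 𝓦 𝓨) (i : ι) : Measure 𝓨 :=
  κ ∘ₘ (cond π (idx ⁻¹' {i}))

instance (π : Measure 𝓦) [IsProbabilityMeasure π] (idx : 𝓦 → ι) (κ : Kernel 𝓦 𝓨)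
    [IsMarkovKernel κ] (i : ι) : IsFiniteMeasure (cellLaw π idx κ i) := by
  unfold cellLaw; infer_instance

lemma isProbabilityMeasure_cellLaw {π : Measure 𝓦} [IsProbabilityMeasure π] {idx : 𝓦 → ι}
    (κ : Kernel 𝓦 𝓨) [IsMarkovKernel κ] {i : ι} (h : π (idx ⁻¹' {i}) ≠ 0) :
    IsProbabilityMeasure (cellLaw π idx κ i) := by
  have := cond_isProbabilityMeasure (μ := π) h
  unfold cellLaw; infer_instance

lemma measure_smul_cond {π : Measure 𝓦} [IsProbabilityMeasure π] (A : Set 𝓦) :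
    π A • cond π A = π.restrict A := by
  rcases eq_or_ne (π A) 0 with h | h
  · rw [h, zero_smul, Measure.restrict_eq_zero.mpr h]
  · rw [ProbabilityTheory.cond, smul_smul, ENNReal.mul_inv_cancel h (measure_ne_top _ _), one_smul]

/-- Conditioning on a cell multiplies probabilities by at most the inverse mass of the cell. For a
null cell both the conditional law and the real inverse are 0. -/
lemma cellLaw_le {π : Measure 𝓦} [IsProbabilityMeasure π] (idx : 𝓦 → ι) (κ : Kernel 𝓦 𝓨) (i : ι) :
    cellLaw π idx κ i ≤ ENNReal.ofReal (π.real (idx ⁻¹' {i}))⁻¹ • (κ ∘ₘ π) := by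
  refine comp_le_smul_comp ?_ κ
  rcases eq_or_ne (π (idx ⁻¹' {i})) 0 with h | h
  · rw [cond_eq_zero_of_meas_eq_zero h]
    exact Measure.zero_le _
  · have hpos : 0 < π.real (idx ⁻¹' {i}) := ENNReal.toReal_pos h (measure_ne_top _ _)
    rw [ENNReal.ofReal_inv_of_pos hpos, Measure.real, ENNReal.ofReal_toReal (measure_ne_top _ _),
      ProbabilityTheory.cond]
    refine Measure.le_iff.mpr fun s _ => ?_
    simp only [Measure.smul_apply, smul_eq_mul]
    gcongr
    exact Measure.restrict_le_self

variable [Fintype ι] [MeasurableSpace ι] [MeasurableSingletonClass ι]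

lemma map_compProd_eq_sum {π : Measure 𝓦} [IsProbabilityMeasure π] {idx : 𝓦 → ι}
    (hidx : Measurable idx) (κ : Kernel 𝓦 𝓨) [IsMarkovKernel κ] :
    (π ⊗ₘ κ).map (Prod.map idx id)
      = ∑ i, π (idx ⁻¹' {i}) • (cellLaw π idx κ i).map (Prod.mk i) := by
  classical
  have hT : Measurable (Prod.map idx id : 𝓦 × 𝓨 → ι × 𝓨) := hidx.prodMap measurable_id
  ext s hs
  have hsi : ∀ i, MeasurableSet (Prod.mk i ⁻¹' s) := fun i => measurable_prodMk_left hs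
  rw [Measure.map_apply hT hs, Measure.compProd_apply (hT hs), Measure.finsetSum_apply]
  have hsum : ∀ w, κ w (Prod.mk w ⁻¹' (Prod.map idx id ⁻¹' s))
      = ∑ i, (idx ⁻¹' {i}).indicator (fun w => κ w (Prod.mk i ⁻¹' s)) w := fun w => by
    rw [Finset.sum_eq_single (idx w)]
    · simp [indicator]; rfl
    · intro j _ hj
      simp [indicator, hj.symm]
    · simp
  simp_rw [hsum]
  rw [lintegral_finsetSum _ fun i _ =>
    (κ.measurable_coe (hsi i)).indicator (hidx (measurableSet_singleton i))]
  refine Finset.sum_congr rfl fun i _ => ?_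
  rw [lintegral_indicator (hidx (measurableSet_singleton i)), ← measure_smul_cond,
    lintegral_smul_measure, Measure.smul_apply, Measure.map_apply measurable_prodMk_left hs,
    cellLaw, Measure.bind_apply (hsi i) κ.aemeasurable]

lemma map_prod_eq_sum {π : Measure 𝓦} [IsProbabilityMeasure π] {idx : 𝓦 → ι}
    (hidx : Measurable idx) (m : Measure 𝓨) [IsProbabilityMeasure m] :
    (π.prod m).map (Prod.map idx id) = ∑ i, π (idx ⁻¹' {i}) • m.map (Prod.mk i) := by
  rw [← Measure.compProd_const, map_compProd_eq_sum hidx]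
  refine Finset.sum_congr rfl fun i _ => ?_
  rcases eq_or_ne (π (idx ⁻¹' {i})) 0 with h | h
  · simp [h]
  · have := cond_isProbabilityMeasure (μ := π) h
    rw [cellLaw, Measure.const_comp, measure_univ, one_smul]

lemma integral_map_prod_eq_sum {π : Measure 𝓦} [IsProbabilityMeasure π] {idx : 𝓦 → ι}
    (hidx : Measurable idx) (m : Measure 𝓨) [IsProbabilityMeasure m] {h : ι × 𝓨 → ℝ}
    (hm : Measurable h) {B : ℝ} (hB : ∀ p, |h p| ≤ B) :
    ∫ p, h p ∂((π.prod m).map (Prod.map idx id))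
      = ∑ i, π.real (idx ⁻¹' {i}) * ∫ y, h (i, y) ∂m := by
  rw [map_prod_eq_sum hidx, integral_finsetSum_measure]
  · refine Finset.sum_congr rfl fun i _ => ?_
    rw [integral_smul_measure, integral_map measurable_prodMk_left.aemeasurable
      hm.aestronglyMeasurable]
    rfl
  · intro i _
    have : IsFiniteMeasure (m.map (Prod.mk i)) := inferInstance
    exact (Integrable.of_bound hm.aestronglyMeasurable B (ae_of_all _ hB)).smul_measure
      (measure_ne_top _ _)

/-- With finitely many cells, the separate densities assemble into a jointly measurable one without
any countability assumption on the spaces. -/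
lemma exists_cell_density {π : Measure 𝓦} [IsProbabilityMeasure π] {idx : 𝓦 → ι}
    (hidx : Measurable idx) (κ : Kernel 𝓦 𝓨) [IsMarkovKernel κ] :
    ∃ (g : ι × 𝓨 → ℝ) (C : ℝ), Measurable g ∧ (∀ p, 0 ≤ g p) ∧ (∀ p, g p ≤ C) ∧
      (∀ i, cellLaw π idx κ i = (κ ∘ₘ π).withDensity fun y => ENNReal.ofReal (g (i, y))) ∧
      (π ⊗ₘ κ).map (Prod.map idx id) = ((π.prod (κ ∘ₘ π)).map (Prod.map idx id)).withDensity
        fun p => ENNReal.ofReal (g p) := by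
  have hex := fun i => exists_bounded_density (ν := cellLaw π idx κ i) (μ := κ ∘ₘ π)
    (inv_nonneg.mpr measureReal_nonneg) (cellLaw_le idx κ i)
  choose g hg hg0 hgC hν using hex
  have hgm : Measurable fun p : ι × 𝓨 => g p.1 p.2 :=
    measurable_from_prod_countable_right fun i => hg i
  refine ⟨fun p => g p.1 p.2, ∑ i, (π.real (idx ⁻¹' {i}))⁻¹, hgm, fun _ => hg0 _ _,
    fun p => (hgC _ _).trans ?_, hν, ?_⟩
  · exact Finset.single_le_sum (f := fun i => (π.real (idx ⁻¹' {i}))⁻¹)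
      (fun i _ => inv_nonneg.mpr measureReal_nonneg) (Finset.mem_univ p.1)
  · rw [map_compProd_eq_sum hidx, map_prod_eq_sum hidx]
    ext s hs
    have hsi : ∀ i, MeasurableSet (Prod.mk i ⁻¹' s) := fun i => measurable_prodMk_left hs
    rw [withDensity_apply _ hs, ← Measure.restrictₗ_apply, map_sum, lintegral_finsetSum_measure,
      Measure.finsetSum_apply]
    refine Finset.sum_congr rfl fun i _ => ?_
    rw [Measure.restrictₗ_apply, Measure.restrict_smul, lintegral_smul_measure,
      setLIntegral_map hs hgm.ennreal_ofReal measurable_prodMk_left, Measure.smul_apply,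
      Measure.map_apply measurable_prodMk_left hs, hν i, withDensity_apply _ (hsi i)]

/-- The mutual information decreases when its first argument is quantised. -/
lemma sum_phiDiv_le_phiMutualInfo {φ : ℝ → ℝ} (hφ : ConvexOn ℝ (Ici 0) φ)
    {π : Measure 𝓦} [IsProbabilityMeasure π] {idx : 𝓦 → ι}
    (hidx : Measurable idx) (κ : Kernel 𝓦 𝓨) [IsMarkovKernel κ] {g : ι × 𝓨 → ℝ} {C : ℝ}
    (hg : Measurable g) (h0 : ∀ p, 0 ≤ g p) (hC : ∀ p, g p ≤ C)
    (hmap : (π ⊗ₘ κ).map (Prod.map idx id)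
      = ((π.prod (κ ∘ₘ π)).map (Prod.map idx id)).withDensity fun p => ENNReal.ofReal (g p)) :
    ((∑ i, π.real (idx ⁻¹' {i}) * ∫ y, φ (g (i, y)) ∂(κ ∘ₘ π) : ℝ) : EReal)
      ≤ phiMutualInfo φ (π ⊗ₘ κ) := by
  have hT : Measurable (Prod.map idx id : 𝓦 × 𝓨 → ι × 𝓨) := hidx.prodMap measurable_id
  rw [phiMutualInfo, Measure.fst_compProd, Measure.snd_compProd]
  set Q := π ⊗ₘ κ with hQ
  set μ := π.prod (κ ∘ₘ π) with hμ
  have hu : Measurable fun p : 𝓦 × 𝓨 => g (Prod.map idx id p) := hg.comp hT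
  have hlhs : ∑ i, π.real (idx ⁻¹' {i}) * ∫ y, φ (g (i, y)) ∂(κ ∘ₘ π)
      = ∫ p, φ (g (Prod.map idx id p)) ∂μ := by
    obtain ⟨B, hB⟩ := exists_abs_le_of_convexOn hφ C
    have hm := measurable_comp_of_convexOn hφ hg h0
    rw [← integral_map_prod_eq_sum hidx (κ ∘ₘ π) hm (fun p => hB _ (h0 p) (hC p)),
      integral_map hT.aemeasurable hm.aestronglyMeasurable]
  rw [hlhs]
  have hmapu : Q.map (fun p => g (Prod.map idx id p))
      = (μ.withDensity fun p => ENNReal.ofReal (g (Prod.map idx id p))).map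
        fun p => g (Prod.map idx id p) := by
    ext S hS
    have hgS := hg hS
    have hpre : (fun p : 𝓦 × 𝓨 => g (Prod.map idx id p)) ⁻¹' S
      = Prod.map idx id ⁻¹' (g ⁻¹' S) := rfl
    rw [Measure.map_apply hu hS, Measure.map_apply hu hS, hpre, ← Measure.map_apply hT hgS, hmap,
      withDensity_apply _ hgS, withDensity_apply _ (hT hgS),
      setLIntegral_map hgS hg.ennreal_ofReal hT]
  unfold phiDiv
  split_ifs with hint
  swap
  · exact le_top
  have hdec : Q = μ.withDensity (Q.rnDeriv μ) + Q.singularPart μ := by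
    rw [add_comm]; exact Q.haveLebesgueDecomposition_add μ
  have core := fun M hM => integral_comp_le_of_map_eq hφ (Measure.measurable_rnDeriv Q μ) hdec hu
    (fun _ => h0 _) (fun _ => hC _) hmapu hint (M := M) hM
  -- The recession slope serves as `M`. It is irrelevant without a singular part, and if it is
  -- infinite with one present, the right side is `⊤`.
  rcases eq_or_ne (Q.singularPart μ) 0 with hs | hs
  · have := core 0 (Or.inl hs)
    simp only [zero_mul, add_zero] at this
    rw [hs]
    simpa using this
  · have hs' : 0 < Q.singularPart μ univ := by
      rwa [pos_iff_ne_zero, Ne, Measure.measure_univ_eq_zero]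
    have hbot : recessionSlope φ ≠ ⊥ := by
      refine ne_bot_of_le_ne_bot (EReal.coe_ne_bot ((φ 1 - φ 0) / 1)) ?_
      exact le_iSup₂_of_le (f := fun (t : ℝ) (_ : 0 < t) => (((φ t - φ 0) / t : ℝ) : EReal)) 1
        one_pos le_rfl
    rcases eq_or_ne (recessionSlope φ) ⊤ with htop | htop
    · rw [htop, EReal.top_mul_of_pos (by exact_mod_cast hs'), EReal.coe_add_top]
      exact le_top
    · have hMdef := EReal.coe_toReal htop hbot
      set M := (recessionSlope φ).toReal
      have hM : ∀ t, 0 < t → φ t - φ 0 ≤ M * t := fun t ht => by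
        have : (((φ t - φ 0) / t : ℝ) : EReal) ≤ recessionSlope φ :=
          le_iSup₂_of_le (f := fun (t : ℝ) (_ : 0 < t) => (((φ t - φ 0) / t : ℝ) : EReal)) t ht
            le_rfl
        rw [← hMdef, EReal.coe_le_coe_iff, div_le_iff₀ ht] at this
        exact this
      have := core M (Or.inr hM)
      have hσ : ((Q.singularPart μ univ : ℝ≥0∞) : EReal)
          = (((Q.singularPart μ).real univ : ℝ) : EReal) := by
        rw [Measure.real, EReal.coe_ennreal_toReal (measure_ne_top _ _)]
      rw [← hMdef, hσ]
      exact_mod_cast this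

end Cells

/-! ### Strong data processing after quantisation -/

section Quantised

variable {𝓦 𝓧 𝓩 𝓥 ι : Type*} [MeasurableSpace 𝓦] [MeasurableSpace 𝓧] [MeasurableSpace 𝓩]
  [MeasurableSpace 𝓥] [Fintype ι] [MeasurableSpace ι] [MeasurableSingletonClass ι]

lemma integral_density_nonneg {Ω : Type*} [MeasurableSpace Ω] {φ : ℝ → ℝ}
    (hφ : ConvexOn ℝ (Ici 0) φ) (hφ1 : φ 1 = 0) {μ : Measure Ω} [IsProbabilityMeasure μ]
    {g : Ω → ℝ} {C : ℝ} (hg : Measurable g) (h0 : ∀ x, 0 ≤ g x) (hC : ∀ x, g x ≤ C)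
    [IsProbabilityMeasure (μ.withDensity fun x => ENNReal.ofReal (g x))] :
    0 ≤ ∫ x, φ (g x) ∂μ := by
  have hgi : Integrable g μ := Integrable.of_bound hg.aestronglyMeasurable C
    (ae_of_all _ fun x => by rw [Real.norm_of_nonneg (h0 x)]; exact hC x)
  have h1 : ∫ x, g x ∂μ = 1 := by
    have := measure_univ (μ := μ.withDensity fun x => ENNReal.ofReal (g x))
    rw [withDensity_apply _ .univ, setLIntegral_univ] at this
    rw [integral_eq_lintegral_of_nonneg_ae (ae_of_all _ h0) hg.aestronglyMeasurable, this]
    rfl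
  have := measureReal_mul_le_integral hφ h0 hgi (integrable_comp_of_bounded hφ hg h0 hC)
  simpa [h1, hφ1] using this

/-- Strong data processing for the quantised mutual information: after quantising `W` to finitely
many values, `(W, Ŵ)` has a bounded density whose divergence is at most the contracted mutual
information. -/
lemma exists_quantised_density {φ : ℝ → ℝ} (hφ : ConvexOn ℝ (Ici 0) φ) (hφ1 : φ 1 = 0)
    {π : Measure 𝓦} [IsProbabilityMeasure π] {idx : 𝓦 → ι} (hidx : Measurable idx)
    (P : Kernel 𝓦 𝓧) [IsMarkovKernel P] (T : Kernel 𝓧 𝓩) [IsMarkovKernel T]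
    (E : Kernel 𝓩 𝓥) [IsMarkovKernel E] :
    ∃ (g : ι × 𝓥 → ℝ) (C : ℝ), Measurable g ∧ (∀ p, 0 ≤ g p) ∧ (∀ p, g p ≤ C) ∧
      (π ⊗ₘ (E ∘ₖ (T ∘ₖ P))).map (Prod.map idx id)
        = ((π.prod ((E ∘ₖ (T ∘ₖ P)) ∘ₘ π)).map (Prod.map idx id)).withDensity
          (fun p => ENNReal.ofReal (g p)) ∧
      ((∫ p, φ (g p) ∂((π.prod ((E ∘ₖ (T ∘ₖ P)) ∘ₘ π)).map (Prod.map idx id)) : ℝ) : EReal)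
        ≤ (etaSup φ E : EReal) * (eta φ (P ∘ₘ π) T : EReal) * phiMutualInfo φ (π ⊗ₘ P) := by
  obtain ⟨f, D, hf, hf0, hfD, hfν, hfmap⟩ := exists_cell_density hidx P (π := π)
  obtain ⟨g, C, hg, hg0, hgC, hgν, hgmap⟩ := exists_cell_density hidx (E ∘ₖ (T ∘ₖ P)) (π := π)
  refine ⟨g, C, hg, hg0, hgC, hgmap, ?_⟩
  set κ := E ∘ₖ (T ∘ₖ P) with hκ
  have hI := sum_phiDiv_le_phiMutualInfo hφ hidx P hf hf0 hfD hfmap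
  obtain ⟨B, hB⟩ := exists_abs_le_of_convexOn hφ C
  rw [integral_map_prod_eq_sum hidx (κ ∘ₘ π) (measurable_comp_of_convexOn hφ hg hg0)
    (fun p => hB _ (hg0 p) (hgC p))]
  have hfi : ∀ i, Measurable fun y => f (i, y) := fun i => hf.comp measurable_prodMk_left
  have hgi : ∀ i, Measurable fun y => g (i, y) := fun i => hg.comp measurable_prodMk_left
  -- All cells share the reference law `P ∘ₘ π`, so one pair of coefficients serves them all: first
  -- `T` contracts, then `E` at the reference law `T ∘ₘ (P ∘ₘ π)`.
  have hcell : ∀ i, ENNReal.ofReal (π.real (idx ⁻¹' {i}) * ∫ y, φ (g (i, y)) ∂(κ ∘ₘ π))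
      ≤ etaSup φ E * eta φ (P ∘ₘ π) T
        * ENNReal.ofReal (π.real (idx ⁻¹' {i}) * ∫ y, φ (f (i, y)) ∂(P ∘ₘ π)) := fun i => by
    rcases eq_or_ne (π (idx ⁻¹' {i})) 0 with h | h
    · simp [Measure.real, h]
    have := isProbabilityMeasure_cellLaw P h
    have h1 := toENNReal_phiDiv_comp_le hφ hφ1 (inv_nonneg.mpr measureReal_nonneg)
      (cellLaw_le (π := π) idx P i) T
    have hTle := comp_le_smul_comp (cellLaw_le (π := π) idx P i) T
    have h2 := toENNReal_phiDiv_comp_le hφ hφ1 (inv_nonneg.mpr measureReal_nonneg) hTle E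
    have e1 : E ∘ₘ (T ∘ₘ cellLaw π idx P i) = cellLaw π idx κ i := by
      simp only [cellLaw, hκ, Measure.comp_assoc]
    have e2 : E ∘ₘ (T ∘ₘ (P ∘ₘ π)) = κ ∘ₘ π := by
      simp only [hκ, Measure.comp_assoc]
    rw [e1, e2, hgν i, phiDiv_withDensity hφ (hgi i) (fun _ => hg0 _) (fun _ => hgC _),
      EReal.real_coe_toENNReal] at h2
    rw [hfν i, phiDiv_withDensity hφ (hfi i) (fun _ => hf0 _) (fun _ => hfD _),
      EReal.real_coe_toENNReal, ← hfν i] at h1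
    rw [ENNReal.ofReal_mul measureReal_nonneg, ENNReal.ofReal_mul measureReal_nonneg]
    calc _ ≤ ENNReal.ofReal (π.real (idx ⁻¹' {i})) * (etaSup φ E * (eta φ (P ∘ₘ π) T
          * ENNReal.ofReal (∫ y, φ (f (i, y)) ∂(P ∘ₘ π)))) := by
          gcongr
          refine h2.trans ?_
          gcongr
          exact eta_le_etaSup φ _ E
      _ = _ := by ring
  have hnonneg : ∀ i, 0 ≤ π.real (idx ⁻¹' {i}) * ∫ y, φ (f (i, y)) ∂(P ∘ₘ π) := fun i => by
    rcases eq_or_ne (π (idx ⁻¹' {i})) 0 with h | h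
    · simp [Measure.real, h]
    have := isProbabilityMeasure_cellLaw P h
    rw [hfν i] at this
    exact mul_nonneg measureReal_nonneg
      (integral_density_nonneg hφ hφ1 (hfi i) (fun _ => hf0 _) (fun _ => hfD _))
  have hI0 : 0 ≤ phiMutualInfo φ (π ⊗ₘ P) :=
    le_trans (by exact_mod_cast Finset.sum_nonneg fun i _ => hnonneg i) hI
  have hIE : ENNReal.ofReal (∑ i, π.real (idx ⁻¹' {i}) * ∫ y, φ (f (i, y)) ∂(P ∘ₘ π))
      ≤ (phiMutualInfo φ (π ⊗ₘ P)).toENNReal := by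
    rw [← EReal.real_coe_toENNReal]; exact EReal.toENNReal_le_toENNReal hI
  -- Subadditivity of `ENNReal.ofReal` suffices on the left; on the right additivity is needed, and
  -- holds as each term is nonnegative by Jensen.
  have hmain : ENNReal.ofReal (∑ i, π.real (idx ⁻¹' {i}) * ∫ y, φ (g (i, y)) ∂(κ ∘ₘ π))
      ≤ etaSup φ E * eta φ (P ∘ₘ π) T * (phiMutualInfo φ (π ⊗ₘ P)).toENNReal := by
    calc _ ≤ ∑ i, ENNReal.ofReal (π.real (idx ⁻¹' {i}) * ∫ y, φ (g (i, y)) ∂(κ ∘ₘ π)) :=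
          Finset.le_sum_of_subadditive _ ENNReal.ofReal_zero.le (fun _ _ => ENNReal.ofReal_add_le) _ _
      _ ≤ ∑ i, etaSup φ E * eta φ (P ∘ₘ π) T
          * ENNReal.ofReal (π.real (idx ⁻¹' {i}) * ∫ y, φ (f (i, y)) ∂(P ∘ₘ π)) :=
          Finset.sum_le_sum fun i _ => hcell i
      _ ≤ _ := by
          rw [← Finset.mul_sum, ← ENNReal.ofReal_sum_of_nonneg fun i _ => hnonneg i]
          gcongr
  rw [← EReal.coe_toENNReal hI0, ← EReal.coe_ennreal_mul, ← EReal.coe_ennreal_mul]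
  refine le_trans ?_ (EReal.coe_ennreal_le_coe_ennreal_iff.mpr hmain)
  rw [EReal.coe_ennreal_ofReal]
  exact_mod_cast le_max_left _ _

/-- Lower bound of a divergence by the contribution of a single set. -/
lemma measureReal_mul_le_add {Ω : Type*} [MeasurableSpace Ω] {φ : ℝ → ℝ}
    (hφ : ConvexOn ℝ (Ici 0) φ) {μ : Measure Ω} [IsProbabilityMeasure μ]
    {g : Ω → ℝ} {C : ℝ} (hg : Measurable g) (h0 : ∀ x, 0 ≤ g x) (hC : ∀ x, g x ≤ C)
    {c : ℝ} (hc : ∀ t, 0 ≤ t → -c ≤ φ t) {S : Set Ω} (hS : MeasurableSet S) :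
    μ.real S * φ ((μ.withDensity fun x => ENNReal.ofReal (g x)).real S / μ.real S)
      ≤ ∫ x, φ (g x) ∂μ + (1 - μ.real S) * c := by
  have hgi : Integrable g μ := Integrable.of_bound hg.aestronglyMeasurable C
    (ae_of_all _ fun x => by rw [Real.norm_of_nonneg (h0 x)]; exact hC x)
  have hi := integrable_comp_of_bounded (μ := μ) hφ hg h0 hC
  have hJ := measureReal_mul_le_integral (μ := μ.restrict S) hφ h0 hgi.restrict hi.restrict
  have hq : (μ.withDensity fun x => ENNReal.ofReal (g x)).real S = ∫ x in S, g x ∂μ := by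
    rw [Measure.real, withDensity_apply _ hS,
      integral_eq_lintegral_of_nonneg_ae (ae_of_all _ h0) hg.aestronglyMeasurable]
  have hr : (μ.restrict S).real univ = μ.real S := by simp [Measure.real]
  rw [hr, ← hq] at hJ
  have hcompl : (1 - μ.real S) * -c ≤ ∫ x in Sᶜ, φ (g x) ∂μ := by
    calc (1 - μ.real S) * -c = ∫ _ in Sᶜ, -c ∂μ := by
          rw [setIntegral_const, probReal_compl_eq_one_sub hS, smul_eq_mul]
      _ ≤ _ := setIntegral_mono (integrable_const _).integrableOn hi.integrableOn
          fun x => hc _ (h0 x)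
  have := integral_add_compl hS hi
  linarith

end Quantised

/-! ### Approximating events by quantised ones -/

section Approximation

variable {𝓦 𝓥 : Type*} [MeasurableSpace 𝓦] [MeasurableSpace 𝓥]

/-- The sets whose sections over the first factor take finitely many values. -/
def finiteSectionSets (𝓦 𝓥 : Type*) [MeasurableSpace 𝓦] [MeasurableSpace 𝓥] :
    Set (Set (𝓦 × 𝓥)) :=
  {B | ∃ (ι : Type) (_ : Fintype ι) (_ : MeasurableSpace ι) (_ : MeasurableSingletonClass ι)
    (idx : 𝓦 → ι) (S : Set (ι × 𝓥)), Measurable idx ∧ MeasurableSet S ∧ B = Prod.map idx id ⁻¹' S}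

/-- Two sets are brought to a common quantisation by pairing their index maps. -/
lemma isSetAlgebra_finiteSectionSets : IsSetAlgebra (finiteSectionSets 𝓦 𝓥) where
  empty_mem := ⟨Unit, inferInstance, inferInstance, inferInstance, fun _ => (), ∅,
    measurable_const, .empty, by simp⟩
  compl_mem := by
    rintro _ ⟨ι, i1, i2, i3, idx, S, hidx, hS, rfl⟩
    exact ⟨ι, i1, i2, i3, idx, Sᶜ, hidx, hS.compl, rfl⟩
  union_mem := by
    rintro _ _ ⟨ι, i1, i2, i3, idx, S, hidx, hS, rfl⟩ ⟨ι', j1, j2, j3, idx', S', hidx', hS', rfl⟩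
    refine ⟨ι × ι', inferInstance, inferInstance, inferInstance, fun w => (idx w, idx' w),
      (fun p => (p.1.1, p.2)) ⁻¹' S ∪ (fun p => (p.1.2, p.2)) ⁻¹' S', hidx.prodMk hidx', ?_, rfl⟩
    exact (((measurable_fst.comp measurable_fst).prodMk measurable_snd) hS).union
      (((measurable_snd.comp measurable_fst).prodMk measurable_snd) hS')

lemma generateFrom_finiteSectionSets :
    (inferInstance : MeasurableSpace (𝓦 × 𝓥))
      = MeasurableSpace.generateFrom (finiteSectionSets 𝓦 𝓥) := by
  classical
  refine le_antisymm ?_ (MeasurableSpace.generateFrom_le ?_)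
  · change Prod.instMeasurableSpace ≤ _
    rw [← generateFrom_prod]
    refine MeasurableSpace.generateFrom_mono ?_
    rintro _ ⟨s, hs, t, ht, rfl⟩
    -- A rectangle needs only two cells, indexed by the truth value of `w ∈ s`.
    refine ⟨Prop, inferInstance, inferInstance, inferInstance, fun w => w ∈ s,
      {p | p.1} ∩ {p | p.2 ∈ t}, measurable_mem.mpr hs, ?_, by ext; simp⟩
    exact (measurable_fst (measurableSet_setOfPred.mpr measurable_id)).inter (measurable_snd ht)
  · rintro _ ⟨ι, i1, i2, i3, idx, S, hidx, hS, rfl⟩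
    exact (hidx.prodMap measurable_id) hS

/-- Approximating in measure for `Q + μ` controls both laws with the same sets; no absolute
continuity between them is required. -/
lemma exists_seq_finiteSectionSets (Q μ : Measure (𝓦 × 𝓥)) [IsFiniteMeasure Q] [IsFiniteMeasure μ]
    {B : Set (𝓦 × 𝓥)} (hB : MeasurableSet B) :
    ∃ A : ℕ → Set (𝓦 × 𝓥), (∀ n, A n ∈ finiteSectionSets 𝓦 𝓥) ∧
      Filter.Tendsto (fun n => Q.real (A n)) Filter.atTop (nhds (Q.real B)) ∧
      Filter.Tendsto (fun n => μ.real (A n)) Filter.atTop (nhds (μ.real B)) := by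
  have hd := Measure.MeasureDense.of_generateFrom_isSetAlgebra_finite (μ := Q + μ)
    (isSetAlgebra_finiteSectionSets (𝓦 := 𝓦) (𝓥 := 𝓥)) generateFrom_finiteSectionSets
  have hex : ∀ n : ℕ, ∃ t ∈ finiteSectionSets 𝓦 𝓥,
      (Q + μ) (B ∆ t) < ENNReal.ofReal (1 / ((n : ℝ) + 1)) :=
    fun n => hd.approx B hB (measure_ne_top _ _) _ (by positivity)
  choose A hA hlt using hex
  have hlim : ∀ ν : Measure (𝓦 × 𝓥), IsFiniteMeasure ν → ν ≤ Q + μ →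
      Filter.Tendsto (fun n => ν.real (A n)) Filter.atTop (nhds (ν.real B)) := by
    intro ν _ hν
    rw [tendsto_iff_dist_tendsto_zero]
    refine squeeze_zero (fun _ => dist_nonneg) (fun n => ?_)
      (tendsto_one_div_add_atTop_nhds_zero_nat (𝕜 := ℝ))
    have hAm : MeasurableSet (A n) := hd.measurable _ (hA n)
    rw [dist_comm, Real.dist_eq]
    refine (abs_measureReal_sub_le_measureReal_symmDiff hB.nullMeasurableSet
      hAm.nullMeasurableSet).trans ?_
    rw [← ENNReal.toReal_ofReal (show (0 : ℝ) ≤ 1 / ((n : ℝ) + 1) by positivity)]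
    exact ENNReal.toReal_mono ENNReal.ofReal_ne_top ((hν _).trans (hlt n).le)
  exact ⟨A, hA, hlim Q inferInstance (Measure.le_add_right le_rfl),
    hlim μ inferInstance (Measure.le_add_left le_rfl)⟩

end Approximation

/-! ### The binary information inequality -/

section Binary

variable {𝓦 𝓧 𝓩 𝓥 : Type*} [MeasurableSpace 𝓦] [MeasurableSpace 𝓧] [MeasurableSpace 𝓩]
  [MeasurableSpace 𝓥]

/-- A measurable set of pairs `(W, Ŵ)` has limits of probabilities `q` and `r`, under the joint law
and the product law, that satisfy the contracted binary information inequality. -/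
lemma exists_seq_binary_bound {φ : ℝ → ℝ} (hφ : ConvexOn ℝ (Ici 0) φ) (hφ1 : φ 1 = 0)
    {π : Measure 𝓦} [IsProbabilityMeasure π]
    (P : Kernel 𝓦 𝓧) [IsMarkovKernel P] (T : Kernel 𝓧 𝓩) [IsMarkovKernel T]
    (E : Kernel 𝓩 𝓥) [IsMarkovKernel E] {J c : ℝ}
    (hJ : (etaSup φ E : EReal) * (eta φ (P ∘ₘ π) T : EReal) * phiMutualInfo φ (π ⊗ₘ P) ≤ (J : EReal))
    (hc : ∀ t, 0 ≤ t → -c ≤ φ t) {B : Set (𝓦 × 𝓥)} (hB : MeasurableSet B) :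
    ∃ q r : ℕ → ℝ,
      Filter.Tendsto q Filter.atTop (nhds ((π ⊗ₘ (E ∘ₖ (T ∘ₖ P))).real B)) ∧
      Filter.Tendsto r Filter.atTop (nhds ((π.prod ((E ∘ₖ (T ∘ₖ P)) ∘ₘ π)).real B)) ∧
      ∀ n, 0 ≤ q n ∧ 0 ≤ r n ∧ (r n = 0 → q n = 0) ∧
        r n * φ (q n / r n) ≤ J + (1 - r n) * c := by
  obtain ⟨A, hA, hq, hr⟩ := exists_seq_finiteSectionSets (π ⊗ₘ (E ∘ₖ (T ∘ₖ P)))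
    (π.prod ((E ∘ₖ (T ∘ₖ P)) ∘ₘ π)) hB
  refine ⟨_, _, hq, hr, fun n => ⟨measureReal_nonneg, measureReal_nonneg, ?_⟩⟩
  obtain ⟨ι, i1, i2, i3, idx, S, hidx, hS, hAn⟩ := hA n
  obtain ⟨g, C, hg, hg0, hgC, hmap, hle⟩ := exists_quantised_density hφ hφ1 (π := π) hidx P T E
  have hT : Measurable (Prod.map idx id : 𝓦 × 𝓥 → ι × 𝓥) := hidx.prodMap measurable_id
  have hint := EReal.coe_le_coe_iff.mp (hle.trans hJ)
  have hprob : IsProbabilityMeasure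
      ((π.prod ((E ∘ₖ (T ∘ₖ P)) ∘ₘ π)).map (Prod.map idx (id : 𝓥 → 𝓥))) :=
    Measure.isProbabilityMeasure_map hT.aemeasurable
  have hkey := measureReal_mul_le_add hφ hg hg0 hgC hc hS
    (μ := (π.prod ((E ∘ₖ (T ∘ₖ P)) ∘ₘ π)).map (Prod.map idx id))
  -- After quantisation the joint law is absolutely continuous, so `q n / r n` is a genuine ratio or
  -- `0 / 0`.
  have hac : (π ⊗ₘ (E ∘ₖ (T ∘ₖ P))).map (Prod.map idx id)
      ≪ (π.prod ((E ∘ₖ (T ∘ₖ P)) ∘ₘ π)).map (Prod.map idx id) := by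
    rw [hmap]; exact withDensity_absolutelyContinuous _ _
  rw [← hmap, map_measureReal_apply hT hS, map_measureReal_apply hT hS, ← hAn] at hkey
  refine ⟨fun h0 => ?_, by linarith⟩
  rw [hAn, ← map_measureReal_apply hT hS, measureReal_eq_zero_iff] at h0 ⊢
  exact hac h0

end Binary

/-! ### Passing to the limit and enlarging L -/

section Limits

open Filter

variable {φ : ℝ → ℝ} {q r : ℕ → ℝ} {q₀ r₀ J c L t : ℝ}

/-- By convexity, `r (φ(q / r) - φ 0)` does not increase when `r` grows with `q` fixed, so `r` may
be replaced by a larger value. The strict inequality on `t` leaves room for the approximation. -/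
lemma le_of_monotone_of_tendsto (hφ : ConvexOn ℝ (Ici 0) φ) (hmono : MonotoneOn φ (Ici 0))
    (hq : Tendsto q atTop (nhds q₀)) (hr : Tendsto r atTop (nhds r₀))
    (h : ∀ n, 0 ≤ q n ∧ 0 ≤ r n ∧ (r n = 0 → q n = 0) ∧ r n * φ (q n / r n) ≤ J + (1 - r n) * -φ 0)
    (hL : 0 < L) (hrL : r₀ ≤ L) (ht : 0 ≤ t) (htq : t < q₀ / L) :
    φ t ≤ (J + (1 - L) * -φ 0) / L := by
  rw [lt_div_iff₀ hL] at htq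
  -- The approximating `r n` may exceed `L` although its limit does not, hence the maximum.
  have hlim : Tendsto (fun n => q n - t * max L (r n)) atTop (nhds (q₀ - t * max L r₀)) :=
    hq.sub ((tendsto_const_nhds.max hr).const_mul t)
  have hpos : 0 < q₀ - t * max L r₀ := by rw [max_eq_left hrL]; linarith
  obtain ⟨n, hn⟩ := (hlim.eventually_const_lt hpos).exists
  obtain ⟨hq0, hr0, hz, hb⟩ := h n
  set L' := max L (r n) with hL'
  have hLL' : L ≤ L' := le_max_left _ _
  have hrL' : r n ≤ L' := le_max_right _ _
  have hL'pos : 0 < L' := hL.trans_le hLL'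
  have hqpos : 0 < q n := by
    have : 0 ≤ t * L' := by positivity
    linarith
  have hrpos : 0 < r n := hr0.lt_of_ne fun h0 => hqpos.ne' (hz h0.symm)
  have h1 : φ t ≤ φ (q n / L') := by
    refine hmono ht (div_nonneg hq0 hL'pos.le) ?_
    rw [le_div_iff₀ hL'pos]; linarith
  have h2 : φ (q n / L') ≤ r n / L' * φ (q n / r n) + (1 - r n / L') * φ 0 := by
    have := hφ.2 (show q n / r n ∈ Ici (0 : ℝ) from div_nonneg hq0 hr0)
      (show (0 : ℝ) ∈ Ici (0 : ℝ) by simp) (show 0 ≤ r n / L' by positivity)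
      (show 0 ≤ 1 - r n / L' by rw [sub_nonneg, div_le_one hL'pos]; exact hrL') (by ring)
    have e : (r n / L') • (q n / r n) + (1 - r n / L') • (0 : ℝ) = q n / L' := by
      simp only [smul_eq_mul, mul_zero, add_zero]; field_simp
    rwa [e] at this
  have h3 : L' * (φ t - φ 0) ≤ r n * (φ (q n / r n) - φ 0) := by
    have h4 : φ t - φ 0 ≤ r n / L' * (φ (q n / r n) - φ 0) := by linarith
    calc L' * (φ t - φ 0) ≤ L' * (r n / L' * (φ (q n / r n) - φ 0)) := by gcongr
      _ = _ := by field_simp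
  have h5 : L * (φ t - φ 0) ≤ L' * (φ t - φ 0) :=
    mul_le_mul_of_nonneg_right hLL' (sub_nonneg.mpr (hmono (by simp) ht ht))
  rw [le_div_iff₀ hL]
  linarith

/-- Since `φ + c` is nonnegative, the limit of `r (φ + c) ≤ J + c` survives lowering `r₀` to `L`. -/
lemma le_of_antitone_of_tendsto (hanti : AntitoneOn φ (Ici 0)) (hc : ∀ t, 0 ≤ t → -c ≤ φ t)
    (hq : Tendsto q atTop (nhds q₀)) (hr : Tendsto r atTop (nhds r₀))
    (h : ∀ n, 0 ≤ q n ∧ 0 ≤ r n ∧ (r n = 0 → q n = 0) ∧ r n * φ (q n / r n) ≤ J + (1 - r n) * c)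
    (hL : 0 < L) (hLr : L ≤ r₀) (ht : 0 ≤ t) (htq : q₀ / r₀ < t) :
    φ t ≤ (J + (1 - L) * c) / L := by
  have hr₀ : 0 < r₀ := hL.trans_le hLr
  rw [div_lt_iff₀ hr₀] at htq
  have hψ : 0 ≤ φ t + c := by linarith [hc t ht]
  have hlim : Tendsto (fun n => t * r n - q n) atTop (nhds (t * r₀ - q₀)) := (hr.const_mul t).sub hq
  have hev : ∀ᶠ n in atTop, r n * (φ t + c) ≤ J + c := by
    filter_upwards [hlim.eventually_const_lt (sub_pos.mpr htq), hr.eventually_const_lt hr₀]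
      with n hn hrn
    obtain ⟨hq0, hr0, -, hb⟩ := h n
    have h1 : φ t ≤ φ (q n / r n) := by
      refine hanti (div_nonneg hq0 hr0) ht ?_
      rw [div_le_iff₀ hrn]; linarith
    have := mul_le_mul_of_nonneg_left h1 hr0
    linarith
  have h2 : r₀ * (φ t + c) ≤ J + c := le_of_tendsto (hr.mul_const _) hev
  rw [le_div_iff₀ hL]
  have := mul_le_mul_of_nonneg_right hLr hψ
  linarith

end Limits

lemma conjugate_zero_of_monotoneOn {φ : ℝ → ℝ} (h : MonotoneOn φ (Ici 0)) :
    conjugate φ 0 = ((-φ 0 : ℝ) : EReal) := by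
  refine le_antisymm (iSup₂_le fun t ht => ?_) (le_iSup₂_of_le
    (f := fun (t : ℝ) (_ : 0 ≤ t) => ((t * 0 - φ t : ℝ) : EReal)) 0 le_rfl (by simp))
  have := h (show (0:ℝ) ∈ Ici (0:ℝ) by simp) (show t ∈ Ici (0:ℝ) from ht) ht
  exact EReal.coe_le_coe_iff.mpr (by linarith)

lemma neg_coe_le_conjugate (φ : ℝ → ℝ) {t : ℝ} (ht : 0 ≤ t) :
    ((-φ t : ℝ) : EReal) ≤ conjugate φ 0 :=
  le_iSup₂_of_le (f := fun (t : ℝ) (_ : 0 ≤ t) => ((t * 0 - φ t : ℝ) : EReal)) t ht (by simp)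

lemma conjugate_zero_nonneg {φ : ℝ → ℝ} (hφ1 : φ 1 = 0) : 0 ≤ conjugate φ 0 := by
  simpa [hφ1] using neg_coe_le_conjugate φ zero_le_one

/-! ### Solving for the ratio by the generalised inverses -/

section Bounds

variable {𝓦 𝓧 𝓩 𝓥 : Type*} [MeasurableSpace 𝓦] [MeasurableSpace 𝓧] [MeasurableSpace 𝓩]
  [MeasurableSpace 𝓥]

/-- Quantising to a single cell already bounds the product below by a divergence of probability
measures, which is nonnegative by Jensen. -/
lemma contracted_nonneg {φ : ℝ → ℝ} (hφ : ConvexOn ℝ (Ici 0) φ) (hφ1 : φ 1 = 0)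
    {π : Measure 𝓦} [IsProbabilityMeasure π]
    (P : Kernel 𝓦 𝓧) [IsMarkovKernel P] (T : Kernel 𝓧 𝓩) [IsMarkovKernel T]
    (E : Kernel 𝓩 𝓥) [IsMarkovKernel E] :
    0 ≤ (etaSup φ E : EReal) * (eta φ (P ∘ₘ π) T : EReal) * phiMutualInfo φ (π ⊗ₘ P) := by
  obtain ⟨g, C, hg, hg0, hgC, hmap, hle⟩ := exists_quantised_density hφ hφ1 (π := π)
    (idx := fun _ => ()) measurable_const P T E
  have hT : Measurable (Prod.map (fun _ => ()) id : 𝓦 × 𝓥 → Unit × 𝓥) :=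
    measurable_const.prodMap measurable_id
  have h1 := Measure.isProbabilityMeasure_map hT.aemeasurable
    (μ := π.prod ((E ∘ₖ (T ∘ₖ P)) ∘ₘ π))
  have h2 := Measure.isProbabilityMeasure_map hT.aemeasurable (μ := π ⊗ₘ (E ∘ₖ (T ∘ₖ P)))
  rw [hmap] at h2
  exact le_trans (by exact_mod_cast integral_density_nonneg hφ hφ1 hg hg0 hgC) hle

lemma div_le_incTerm {φ : ℝ → ℝ} (hφ : ConvexOn ℝ (Ici 0) φ) (hφ1 : φ 1 = 0)
    (hmono : MonotoneOn φ (Ici 0)) {π : Measure 𝓦} [IsProbabilityMeasure π]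
    (P : Kernel 𝓦 𝓧) [IsMarkovKernel P] (T : Kernel 𝓧 𝓩) [IsMarkovKernel T]
    (E : Kernel 𝓩 𝓥) [IsMarkovKernel E] {B : Set (𝓦 × 𝓥)} (hB : MeasurableSet B)
    {L : ℝ} (hL : 0 < L) (hrL : (π.prod ((E ∘ₖ (T ∘ₖ P)) ∘ₘ π)).real B ≤ L) :
    (((π ⊗ₘ (E ∘ₖ (T ∘ₖ P))).real B / L : ℝ) : EReal)
      ≤ incTerm φ ((etaSup φ E : EReal) * (eta φ (P ∘ₘ π) T : EReal)
        * phiMutualInfo φ (π ⊗ₘ P)) L := by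
  have hJ0 := contracted_nonneg hφ hφ1 (π := π) P T E
  set J := (etaSup φ E : EReal) * (eta φ (P ∘ₘ π) T : EReal) * phiMutualInfo φ (π ⊗ₘ P) with hJ
  rw [incTerm, conjugate_zero_of_monotoneOn hmono]
  refine le_iInf fun t => le_iInf fun ht => le_iInf fun hlt => EReal.coe_le_coe_iff.mpr ?_
  by_contra! htq
  -- Infinite information leaves no `t` in the infimum defining the inverse.
  rcases eq_or_ne J ⊤ with htop | htop
  · rw [htop, ← EReal.coe_mul, EReal.top_add_coe,
      EReal.top_div_of_pos_ne_top (by exact_mod_cast hL) (EReal.coe_ne_top _)] at hlt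
    exact not_top_lt hlt
  have hJr := EReal.coe_toReal htop (ne_bot_of_le_ne_bot EReal.zero_ne_bot hJ0)
  obtain ⟨q, r, hq, hr, h⟩ := exists_seq_binary_bound hφ hφ1 P T E (J := J.toReal) (c := -φ 0)
    (by rw [hJr]) (fun t ht => by rw [neg_neg]; exact hmono (by simp) ht ht) hB
  have := le_of_monotone_of_tendsto hφ hmono hq hr h hL hrL ht htq
  rw [← hJr, ← EReal.coe_mul, ← EReal.coe_add, ← EReal.coe_div, EReal.coe_lt_coe_iff] at hlt
  linarith

lemma decTerm_le_div {φ : ℝ → ℝ} (hφ : ConvexOn ℝ (Ici 0) φ) (hφ1 : φ 1 = 0)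
    (hanti : AntitoneOn φ (Ici 0)) {π : Measure 𝓦} [IsProbabilityMeasure π]
    (P : Kernel 𝓦 𝓧) [IsMarkovKernel P] (T : Kernel 𝓧 𝓩) [IsMarkovKernel T]
    (E : Kernel 𝓩 𝓥) [IsMarkovKernel E] {B : Set (𝓦 × 𝓥)} (hB : MeasurableSet B)
    {L : ℝ} (hL : L < 1) (hrL : (π.prod ((E ∘ₖ (T ∘ₖ P)) ∘ₘ π)).real B ≤ L)
    (hLc : 0 < L ∨ conjugate φ 0 ≠ ⊤) :
    decTerm φ ((etaSup φ E : EReal) * (eta φ (P ∘ₘ π) T : EReal) * phiMutualInfo φ (π ⊗ₘ P)) L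
      ≤ (((π ⊗ₘ (E ∘ₖ (T ∘ₖ P))).real Bᶜ / (π.prod ((E ∘ₖ (T ∘ₖ P)) ∘ₘ π)).real Bᶜ : ℝ)
        : EReal) := by
  have hJ0 := contracted_nonneg hφ hφ1 (π := π) P T E
  set J := (etaSup φ E : EReal) * (eta φ (P ∘ₘ π) T : EReal) * phiMutualInfo φ (π ⊗ₘ P) with hJ
  have hL0 : 0 ≤ L := measureReal_nonneg.trans hrL
  have hc0 := conjugate_zero_nonneg hφ1
  have h1L : (0 : EReal) < ((1 - L : ℝ) : EReal) := by exact_mod_cast sub_pos.mpr hL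
  have hLr : 1 - L ≤ (π.prod ((E ∘ₖ (T ∘ₖ P)) ∘ₘ π)).real Bᶜ := by
    rw [probReal_compl_eq_one_sub hB]; linarith
  -- It is enough that every `t` strictly above the ratio is admissible in the infimum; the ratio
  -- itself may fail to be, as φ can jump at 0.
  suffices hmain : ∀ t : ℝ, (π ⊗ₘ (E ∘ₖ (T ∘ₖ P))).real Bᶜ
      / (π.prod ((E ∘ₖ (T ∘ₖ P)) ∘ₘ π)).real Bᶜ < t →
      (φ t : EReal) ≤ (J + (L : EReal) * conjugate φ 0) / ((1 - L : ℝ) : EReal) by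
    refine EReal.le_of_forall_lt_iff_le.mp fun t ht => ?_
    have ht' := EReal.coe_lt_coe_iff.mp ht
    have ht0 : 0 ≤ t := le_trans (div_nonneg measureReal_nonneg measureReal_nonneg) ht'.le
    exact iInf_le_of_le t (iInf_le_of_le ht0 (iInf_le_of_le (hmain t ht') le_rfl))
  intro t ht
  have ht0 : 0 ≤ t := le_trans (div_nonneg measureReal_nonneg measureReal_nonneg) ht.le
  by_cases htop : J + (L : EReal) * conjugate φ 0 = ⊤
  · rw [htop, EReal.top_div_of_pos_ne_top h1L (EReal.coe_ne_top _)]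
    exact le_top
  have hLc0 : 0 ≤ (L : EReal) * conjugate φ 0 := mul_nonneg (by exact_mod_cast hL0) hc0
  have hJtop : J ≠ ⊤ := fun h => htop (by
    rw [h, EReal.top_add_of_ne_bot (ne_bot_of_le_ne_bot EReal.zero_ne_bot hLc0)])
  -- The side condition rules out `0 * ⊤`, which evaluates to 0 and would hide an infinite
  -- conjugate.
  have hctop : conjugate φ 0 ≠ ⊤ := by
    rcases hLc with h | h
    · intro h'
      apply htop
      rw [h', EReal.mul_top_of_pos (by exact_mod_cast h),
        EReal.add_top_of_ne_bot (ne_bot_of_le_ne_bot EReal.zero_ne_bot hJ0)]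
    · exact h
  have hJr := EReal.coe_toReal hJtop (ne_bot_of_le_ne_bot EReal.zero_ne_bot hJ0)
  have hcr := EReal.coe_toReal hctop (ne_bot_of_le_ne_bot EReal.zero_ne_bot hc0)
  have hc : ∀ t, 0 ≤ t → -(conjugate φ 0).toReal ≤ φ t := fun t ht => by
    have := neg_coe_le_conjugate φ ht
    rw [← hcr, EReal.coe_le_coe_iff] at this
    linarith
  obtain ⟨q, r, hq, hr, h⟩ := exists_seq_binary_bound hφ hφ1 P T E (J := J.toReal)
    (by rw [hJr]) hc hB.compl
  have := le_of_antitone_of_tendsto hanti hc hq hr h (sub_pos.mpr hL) hLr ht0 ht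
  rw [← hJr, ← hcr, ← EReal.coe_mul, ← EReal.coe_add, ← EReal.coe_div, EReal.coe_le_coe_iff]
  simpa using this

end Bounds

/-! ### Markov's inequality and small balls -/

section Risk

variable {𝓦 𝓥 : Type*} [MeasurableSpace 𝓦] [MeasurableSpace 𝓥]

lemma measurableSet_loss_lt {ℓ : 𝓦 → 𝓥 → ℝ≥0} {ρ : ℝ}
    (hℓ : Measurable (Function.uncurry ℓ)) :
    MeasurableSet {p : 𝓦 × 𝓥 | (ℓ p.1 p.2 : ℝ) < ρ} :=
  measurableSet_lt hℓ.coe_nnreal_real measurable_const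

lemma mul_measureReal_compl_le_risk {ℓ : 𝓦 → 𝓥 → ℝ≥0} (hℓ : Measurable (Function.uncurry ℓ))
    (Q : Measure (𝓦 × 𝓥)) [IsFiniteMeasure Q] {ρ : ℝ} (hρ : 0 < ρ) :
    ((ρ * Q.real {p | (ℓ p.1 p.2 : ℝ) < ρ}ᶜ : ℝ) : EReal) ≤ (risk ℓ Q : EReal) := by
  have hm : Measurable fun p : 𝓦 × 𝓥 => (ℓ p.1 p.2 : ℝ≥0∞) := hℓ.coe_nnreal_ennreal
  have hset : {p : 𝓦 × 𝓥 | (ℓ p.1 p.2 : ℝ) < ρ}ᶜ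
      = {p | ENNReal.ofReal ρ ≤ (ℓ p.1 p.2 : ℝ≥0∞)} := by
    ext p
    simp only [mem_compl_iff, mem_ofPred_eq, not_lt, ENNReal.ofReal_le_coe]
  have h := mul_meas_ge_le_lintegral (μ := Q) hm (ENNReal.ofReal ρ)
  rw [← hset] at h
  refine le_trans (le_of_eq ?_) (EReal.coe_ennreal_le_coe_ennreal_iff.mpr h)
  rw [EReal.coe_ennreal_mul, EReal.coe_ennreal_ofReal, max_eq_left hρ.le, EReal.coe_mul,
    Measure.real, EReal.coe_ennreal_toReal (measure_ne_top _ _)]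

/-- Under the product law, Fubini writes the probability as an average over Ŵ of probabilities of
balls, each at most the supremum. -/
lemma ballProb_le_smallBallProb {ℓ : 𝓦 → 𝓥 → ℝ≥0} (hℓ : Measurable (Function.uncurry ℓ))
    (π : Measure 𝓦) [IsProbabilityMeasure π] (m : Measure 𝓥) [IsProbabilityMeasure m] (ρ : ℝ) :
    (π.prod m).real {p | (ℓ p.1 p.2 : ℝ) < ρ} ≤ smallBallProb ℓ π ρ := by
  have hB := measurableSet_loss_lt (ρ := ρ) hℓ
  have hbdd : BddAbove (range fun v => π.real {w | (ℓ w v : ℝ) < ρ}) :=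
    ⟨1, by rintro _ ⟨v, rfl⟩; exact measureReal_le_one⟩
  have h0 : 0 ≤ smallBallProb ℓ π ρ := Real.iSup_nonneg fun _ => measureReal_nonneg
  refine ENNReal.toReal_le_of_le_ofReal h0 ?_
  rw [Measure.prod_apply_symm hB]
  calc ∫⁻ v, π ((fun w => (w, v)) ⁻¹' {p | (ℓ p.1 p.2 : ℝ) < ρ}) ∂m
      ≤ ∫⁻ _, ENNReal.ofReal (smallBallProb ℓ π ρ) ∂m := by
        refine lintegral_mono fun v => ?_
        rw [ENNReal.le_ofReal_iff_toReal_le (measure_ne_top _ _) h0]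
        exact le_ciSup hbdd v
    _ = _ := by simp

end Risk

instance {𝓧 𝓩 : Type*} [MeasurableSpace 𝓧] [MeasurableSpace 𝓩] (K : Kernel 𝓧 𝓩)
    [IsMarkovKernel K] (n : ℕ) : IsMarkovKernel (tensorPower K n) :=
  ⟨fun x => by
    change IsProbabilityMeasure (Measure.pi fun i => K (x i))
    infer_instance⟩

/-! ### The risk bounds -/

section Framework

variable {𝓦 𝓥 𝓧 𝓩 : Type*} [MeasurableSpace 𝓦] [MeasurableSpace 𝓥] [MeasurableSpace 𝓧]
  [MeasurableSpace 𝓩] {n : ℕ} {π : Measure 𝓦} [IsProbabilityMeasure π]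
  (P : Kernel 𝓦 (Fin n → 𝓧)) [IsMarkovKernel P] (K : Kernel 𝓧 𝓩) [IsMarkovKernel K]
  (E : Kernel (Fin n → 𝓩) 𝓥) [IsMarkovKernel E] {ℓ : 𝓦 → 𝓥 → ℝ≥0}
  {φ : ℝ → ℝ} {ρ L : ℝ}

instance : IsProbabilityMeasure (jointWEst π P K E) := by
  unfold jointWEst; infer_instance

lemma ballProb_jointWEst :
    ballProb ℓ (jointWEst π P K E) ρ
      = (π.prod ((E ∘ₖ (tensorPower K n ∘ₖ P)) ∘ₘ π)).real {p | (ℓ p.1 p.2 : ℝ) < ρ} := by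
  rw [ballProb, jointWEst, Measure.fst_compProd, Measure.snd_compProd]

lemma risk_ge_of_monotoneOn (hℓ : Measurable (Function.uncurry ℓ))
    (hφ : ConvexOn ℝ (Ici 0) φ) (hφ1 : φ 1 = 0) (hmono : MonotoneOn φ (Ici 0)) (hρ : 0 < ρ)
    (hL : 0 < L) (hrL : ballProb ℓ (jointWEst π P K E) ρ ≤ L) :
    (ρ : EReal) * (1 - (L : EReal) * incTerm φ (contractedInfo φ π P K E) L)
      ≤ (risk ℓ (jointWEst π P K E) : EReal) := by
  have hB := measurableSet_loss_lt (ρ := ρ) hℓ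
  rw [ballProb_jointWEst] at hrL
  have h := div_le_incTerm hφ hφ1 hmono P (tensorPower K n) E hB hL hrL
  refine le_trans ?_ (mul_measureReal_compl_le_risk hℓ (jointWEst π P K E) hρ)
  rw [probReal_compl_eq_one_sub hB, EReal.coe_mul, EReal.coe_sub]
  refine mul_le_mul_of_nonneg_left (EReal.sub_le_sub le_rfl ?_) (by exact_mod_cast hρ.le)
  refine le_trans (le_of_eq ?_) (mul_le_mul_of_nonneg_left h (by exact_mod_cast hL.le))
  rw [← EReal.coe_mul, mul_div_cancel₀ _ hL.ne']
  rfl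

lemma risk_ge_of_antitoneOn (hℓ : Measurable (Function.uncurry ℓ))
    (hφ : ConvexOn ℝ (Ici 0) φ) (hφ1 : φ 1 = 0) (hanti : AntitoneOn φ (Ici 0)) (hρ : 0 < ρ)
    (hL : L < 1) (hrL : ballProb ℓ (jointWEst π P K E) ρ ≤ L)
    (hLc : 0 < L ∨ conjugate φ 0 ≠ ⊤) :
    (ρ : EReal) * (1 - (ballProb ℓ (jointWEst π P K E) ρ : EReal))
        * decTerm φ (contractedInfo φ π P K E) L
      ≤ (risk ℓ (jointWEst π P K E) : EReal) := by
  have hB := measurableSet_loss_lt (ρ := ρ) hℓ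
  have hr1 : 0 < 1 - ballProb ℓ (jointWEst π P K E) ρ := by linarith
  rw [ballProb_jointWEst] at hrL hr1 ⊢
  have h := decTerm_le_div hφ hφ1 hanti P (tensorPower K n) E hB hL hrL hLc
  refine le_trans ?_ (mul_measureReal_compl_le_risk hℓ (jointWEst π P K E) hρ)
  rw [probReal_compl_eq_one_sub (μ := π.prod _) hB] at h
  rw [← EReal.coe_one, ← EReal.coe_sub, ← EReal.coe_mul]
  -- The prefactor is the exact product mass of the complement, which cancels the denominator of the
  -- ratio; only the argument of the inverse carries `L`.
  refine (mul_le_mul_of_nonneg_left h (by exact_mod_cast (mul_pos hρ hr1).le)).trans (le_of_eq ?_)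
  rw [← EReal.coe_mul, mul_assoc, mul_div_cancel₀ _ hr1.ne']
  rfl

end Framework

end PhiRisk

theorem mainTheorem5 {𝓦 𝓥 𝓧 𝓩 : Type*} [MeasurableSpace 𝓦] [MeasurableSpace 𝓥]
    [MeasurableSpace 𝓧] [MeasurableSpace 𝓩] (n : ℕ)
    (π : Measure 𝓦) [IsProbabilityMeasure π]
    (P : Kernel 𝓦 (Fin n → 𝓧)) [IsMarkovKernel P]
    (K : Kernel 𝓧 𝓩) [IsMarkovKernel K]
    (E : Kernel (Fin n → 𝓩) 𝓥) [IsMarkovKernel E]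
    (ℓ : 𝓦 → 𝓥 → ℝ≥0) (hℓ : Measurable (Function.uncurry ℓ))
    (φ : ℝ → ℝ) (hφ : ConvexOn ℝ (Ici 0) φ) (hφ1 : φ 1 = 0) :
    (MonotoneOn φ (Ici 0) →
      MonotoneOn (fun p : ℝ × ℝ => PhiRisk.G φ p.1 p.2) (Ici 0 ×ˢ Ioc 0 1) →
      ∀ ρ : ℝ, 0 < ρ →
        (0 < PhiRisk.ballProb ℓ (PhiRisk.jointWEst π P K E) ρ →
          (ρ : EReal) * (1 - (PhiRisk.ballProb ℓ (PhiRisk.jointWEst π P K E) ρ : EReal)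
              * PhiRisk.incTerm φ (PhiRisk.contractedInfo φ π P K E)
                  (PhiRisk.ballProb ℓ (PhiRisk.jointWEst π P K E) ρ))
            ≤ (PhiRisk.risk ℓ (PhiRisk.jointWEst π P K E) : EReal)) ∧
        (0 < PhiRisk.smallBallProb ℓ π ρ →
          (ρ : EReal) * (1 - (PhiRisk.smallBallProb ℓ π ρ : EReal)
              * PhiRisk.incTerm φ (PhiRisk.contractedInfo φ π P K E)
                  (PhiRisk.smallBallProb ℓ π ρ))
            ≤ (PhiRisk.risk ℓ (PhiRisk.jointWEst π P K E) : EReal))) ∧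
    (AntitoneOn φ (Ici 0) →
      ∀ ρ : ℝ, 0 < ρ →
        (PhiRisk.ballProb ℓ (PhiRisk.jointWEst π P K E) ρ < 1 →
          (0 < PhiRisk.ballProb ℓ (PhiRisk.jointWEst π P K E) ρ ∨ PhiRisk.conjugate φ 0 ≠ ⊤) →
          (ρ : EReal) * (1 - (PhiRisk.ballProb ℓ (PhiRisk.jointWEst π P K E) ρ : EReal))
              * PhiRisk.decTerm φ (PhiRisk.contractedInfo φ π P K E)
                  (PhiRisk.ballProb ℓ (PhiRisk.jointWEst π P K E) ρ)
            ≤ (PhiRisk.risk ℓ (PhiRisk.jointWEst π P K E) : EReal)) ∧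
        (PhiRisk.smallBallProb ℓ π ρ < 1 →
          (0 < PhiRisk.smallBallProb ℓ π ρ ∨ PhiRisk.conjugate φ 0 ≠ ⊤) →
          (ρ : EReal) * (1 - (PhiRisk.ballProb ℓ (PhiRisk.jointWEst π P K E) ρ : EReal))
              * PhiRisk.decTerm φ (PhiRisk.contractedInfo φ π P K E)
                  (PhiRisk.smallBallProb ℓ π ρ)
            ≤ (PhiRisk.risk ℓ (PhiRisk.jointWEst π P K E) : EReal))) := by
  refine ⟨fun hmono _ ρ hρ => ⟨fun hL => ?_, fun hL => ?_⟩,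
    fun hanti ρ hρ => ⟨fun hL hLc => ?_, fun hL hLc => ?_⟩⟩
  · exact PhiRisk.risk_ge_of_monotoneOn P K E hℓ hφ hφ1 hmono hρ hL le_rfl
  · refine PhiRisk.risk_ge_of_monotoneOn P K E hℓ hφ hφ1 hmono hρ hL ?_
    rw [PhiRisk.ballProb_jointWEst]
    exact PhiRisk.ballProb_le_smallBallProb hℓ π _ ρ
  · exact PhiRisk.risk_ge_of_antitoneOn P K E hℓ hφ hφ1 hanti hρ hL le_rfl hLc
  · refine PhiRisk.risk_ge_of_antitoneOn P K E hℓ hφ hφ1 hanti hρ hL ?_ hLc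
    rw [PhiRisk.ballProb_jointWEst]
    exact PhiRisk.ballProb_le_smallBallProb hℓ π _ ρ
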